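/- Let $n,m\ge 1$, let $\mathcal X\subseteq\mathbb R^n$ and $\mathcal Y\subseteq\mathbb R^m$ be nonempty closed convex sets, and put $\mathcal Z=\mathcal X\times\mathcal Y$ with $\|z-z'\|\le D$ for all $z,z'\in\mathcal Z$ (Euclidean norm). Let $\mathcal X_1,\mathcal Y_1$ be the sets of points at distance at most $1$ from $\mathcal X$, $\mathcal Y$. Let $f:\mathbb R^n\times\mathbb R^m\to\mathbb R$ be such that $f(\cdot,y)$ is $\mu$-strongly convex on $\mathcal X$ for each $y\in\mathcal Y$ and $f(x,\cdot)$ is $\mu$-strongly concave on $\mathcal Y$ for each $x\in\mathcal X$, where $\mu>0$. On $\mathcal X_1\times\mathcal Y_1$ the partial gradients of $f$ exist, $\nabla_xf$ is $L_x$-Lipschitz in $x$, $\nabla_yf$ is $L_y$-Lipschitz in $y$, and $\nabla_xf$ is $L_{xy}$-Lipschitz in $y$ and $\nabla_yf$ is $L_{xy}$-Lipschitz in $x$. On $\mathcal X\times\mathcal Y$, $\|\nabla_xf\|\le M$ and $\|\nabla_yf\|\le M$. Put $L=2\max(L_x,L_y,L_{xy})$, assume $L\ge\mu$, and put $\kappa=L/\mu$.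 Let $z^*=(x^*,y^*)\in\mathcal Z$ be the saddle point of $\min_{x\in\mathcal X}\max_{y\in\mathcal Y}f(x,y)$. Only a stochastic oracle $\hat f(x,y,\xi)$ with random $\xi$ is available. It is jointly measurable, partially differentiable in $x$ and in $y$ on $\mathcal X_1\times\mathcal Y_1$ for every $\xi$, and for all $(x,y)\in\mathcal X_1\times\mathcal Y_1$ satisfies $\mathbb E\hat f(x,y,\xi)=f(x,y)$, $\mathbb E\nabla_x\hat f=\nabla_xf$, $\mathbb E\nabla_y\hat f=\nabla_yf$, $\mathbb E\|\nabla_x\hat f-\nabla_xf\|^2\le\sigma^2$ and $\mathbb E\|\nabla_y\hat f-\nabla_yf\|^2\le\sigma^2$. For $u,v$ on the unit spheres of $\mathbb R^n,\mathbb R^m$, $z=(x,y)$ and $\rho_x,\rho_y>0$ let $$\hat F_\rho(z,u,v,\xi)=\Big(\tfrac n{\rho_x}\big(\hat f(x+\rho_xu,y,\xi)-\hat f(x,y,\xi)\big)u,\; -\tfrac m{\rho_y}\big(\hat f(x,y+\rho_yv,\xi)-\hat f(x,y,\xi)\big)v\Big).$$ For $h\in\{0,\tfrac12,1,\tfrac32,\dots\}$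 let $\hat F^h_\rho(z)=\frac1{t_h}\sum_{i=1}^{t_h}\hat F_\rho(z,u^h_{(i)},v^h_{(i)},\xi^h_{(i)})$, where all the $\xi^h_{(i)},u^h_{(i)},v^h_{(i)}$ are independent, the $\xi^h_{(i)}$ have the law of $\xi$, and the $u^h_{(i)}$ and $v^h_{(i)}$ are uniform on the unit spheres. Let $P_{\mathcal Z}$ be the projection onto $\mathcal Z$. The stochastic zeroth-order extra-point method starts at some $z^0\in\mathcal Z$, with $z^{-1}=z^0$ and $\hat F^{-1}_\rho(z^{-1})=\hat F^0_\rho(z^0)$, and iterates $$z^{k+0.5}=P_{\mathcal Z}\big(z^k+\beta(z^k-z^{k-1})-\eta\hat F^k_\rho(z^k)\big),$$ $$z^{k+1}=P_{\mathcal Z}\big(z^k-\alpha\hat F^{k+0.5}_\rho(z^{k+0.5})+\gamma(z^k-z^{k-1})-\tau(\hat F^k_\rho(z^k)-\hat F^{k-1}_\rho(z^{k-1}))\big).$$ For a number $K\ge1$ of iterations decided in advance, take $(\alpha,\beta,\gamma,\eta,\tau)=\big(\frac1{4L},\frac1{64\kappa},\frac1{64\kappa},\frac1{4L},\frac1{64L\kappa}\big)$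 and $$t_{k+0.5}=t_k=\Big\lceil K\big(1-\tfrac1{256\kappa}\big)^{-(k+1)}\Big\rceil,\quad \rho_x=\tfrac1{\sqrt2\,n\kappa}\big(1-\tfrac1{256\kappa}\big)^K,\quad \rho_y=\tfrac1{\sqrt2\,m\kappa}\big(1-\tfrac1{256\kappa}\big)^K.$$ Then there is a constant $C>0$ depending only on $n,m,L,M,\sigma,D$ (in particular not on $\mu$, $\kappa$ or $\epsilon$) such that for all $\mu\in(0,L]$ and $\epsilon\in(0,\frac12]$ there is a $K\ge1$, the same for all such problems, oracles and starting points, with $$K\le C\,\kappa\ln\tfrac1\epsilon,\qquad \sum_{k=0}^{K-1}(t_k+t_{k+0.5})\le C\,\frac{\kappa^2}{\epsilon}\ln\tfrac1\epsilon,\qquad \mathbb E\big[\|z^K-z^*\|^2\big]\le\epsilon .$$ -/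

import Mathlib

open MeasureTheory ProbabilityTheory Finset
open scoped Gradient

noncomputable section

namespace SZO

/-- `ℝⁿ` with the Euclidean norm. -/
abbrev E (n : ℕ) : Type := EuclideanSpace ℝ (Fin n)

/-- `ℝⁿ × ℝᵐ` with the Euclidean norm `‖(x, y)‖² = ‖x‖² + ‖y‖²`. -/
abbrev Pt (n m : ℕ) : Type := WithLp 2 (E n × E m)

/-- The feasible set `𝒵 = X × Y`. -/
def feasible {n m : ℕ} (X : Set (E n)) (Y : Set (E m)) : Set (Pt n m) :=
  {z | z.fst ∈ X ∧ z.snd ∈ Y}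

/-- `p` is a point of `Z` nearest to `z`. -/
def IsNearest {V : Type*} [NormedAddCommGroup V] (Z : Set V) (z p : V) : Prop :=
  p ∈ Z ∧ ∀ q ∈ Z, ‖z - p‖ ≤ ‖z - q‖

open Classical in
/-- The projection operator `P_Z`: the nearest point of `Z`. It exists and is unique when `Z` is a
nonempty closed convex set of a Euclidean space, the only case in which it is used. -/
def proj {V : Type*} [NormedAddCommGroup V] (Z : Set V) (z : V) : V :=
  if h : ∃ p, IsNearest Z z p then h.choose else z

/-- The uniform probability distribution on the unit sphere of `ℝⁿ`, as a measure on `ℝⁿ`: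
the normalized surface measure. -/
def uniformSphere (n : ℕ) : Measure (E n) :=
  ((volume : Measure (E n)).toSphere Set.univ)⁻¹ •
    ((volume : Measure (E n)).toSphere).map Subtype.val

/-- The points at distance at most `1` from `X`. The method evaluates the objective at the points
`x + ρ u` with `x ∈ X`, `‖u‖ = 1`, `0 < ρ < 1`, which need not lie in `X`. -/
def enlarge {n : ℕ} (X : Set (E n)) : Set (E n) := Metric.cthickening 1 X

/-- The hypotheses on the saddle-point problem `min_{x ∈ X} max_{y ∈ Y} f x y`. -/
structure IsProblem {n m : ℕ} (X : Set (E n)) (Y : Set (E m)) (f : E n → E m → ℝ)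
    (μ Lx Ly Lxy M D : ℝ) : Prop where
  closed_X : IsClosed X
  closed_Y : IsClosed Y
  convex_X : Convex ℝ X
  convex_Y : Convex ℝ Y
  bounded : ∀ z ∈ feasible X Y, ∀ z' ∈ feasible X Y, ‖z - z'‖ ≤ D
  strongly_convex : ∀ y ∈ Y, StrongConvexOn X μ (fun x => f x y)
  strongly_concave : ∀ x ∈ X, StrongConcaveOn Y μ (fun y => f x y)
  diff_x : ∀ x ∈ enlarge X, ∀ y ∈ enlarge Y, DifferentiableAt ℝ (fun x' => f x' y) x
  diff_y : ∀ x ∈ enlarge X, ∀ y ∈ enlarge Y, DifferentiableAt ℝ (fun y' => f x y') y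
  lip_xx : ∀ x ∈ enlarge X, ∀ x' ∈ enlarge X, ∀ y ∈ enlarge Y,
    ‖∇ (fun w => f w y) x - ∇ (fun w => f w y) x'‖ ≤ Lx * ‖x - x'‖
  lip_yy : ∀ x ∈ enlarge X, ∀ y ∈ enlarge Y, ∀ y' ∈ enlarge Y,
    ‖∇ (fun w => f x w) y - ∇ (fun w => f x w) y'‖ ≤ Ly * ‖y - y'‖
  lip_xy : ∀ x ∈ enlarge X, ∀ y ∈ enlarge Y, ∀ y' ∈ enlarge Y,
    ‖∇ (fun w => f w y) x - ∇ (fun w => f w y') x‖ ≤ Lxy * ‖y - y'‖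
  lip_yx : ∀ x ∈ enlarge X, ∀ x' ∈ enlarge X, ∀ y ∈ enlarge Y,
    ‖∇ (fun w => f x w) y - ∇ (fun w => f x' w) y‖ ≤ Lxy * ‖x - x'‖
  /-- On the convex set `X × Y` the next two bounds say that `f` is `M`-Lipschitz in each
  variable, in the form that also covers sets `X`, `Y` with empty interior. -/
  grad_x_le : ∀ x ∈ X, ∀ y ∈ Y, ‖∇ (fun w => f w y) x‖ ≤ M
  grad_y_le : ∀ x ∈ X, ∀ y ∈ Y, ‖∇ (fun w => f x w) y‖ ≤ M

/-- The hypotheses on the stochastic oracle `fhat x y ξ`, with `ξ` of law `P`: unbiased values,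
unbiased partial gradients, and partial gradients with variance at most `σ²`. -/
structure IsOracle {n m : ℕ} {Ξ : Type*} [MeasurableSpace Ξ] (P : Measure Ξ)
    (X : Set (E n)) (Y : Set (E m)) (f : E n → E m → ℝ) (fhat : E n → E m → Ξ → ℝ)
    (σ : ℝ) : Prop where
  measurable : Measurable (fun p : E n × E m × Ξ => fhat p.1 p.2.1 p.2.2)
  diff_x : ∀ x ∈ enlarge X, ∀ y ∈ enlarge Y, ∀ ξ,
    DifferentiableAt ℝ (fun x' => fhat x' y ξ) x
  diff_y : ∀ x ∈ enlarge X, ∀ y ∈ enlarge Y, ∀ ξ,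
    DifferentiableAt ℝ (fun y' => fhat x y' ξ) y
  mean : ∀ x ∈ enlarge X, ∀ y ∈ enlarge Y,
    Integrable (fun ξ => fhat x y ξ) P ∧ ∫ ξ, fhat x y ξ ∂P = f x y
  mean_grad_x : ∀ x ∈ enlarge X, ∀ y ∈ enlarge Y,
    Integrable (fun ξ => ∇ (fun w => fhat w y ξ) x) P ∧
      ∫ ξ, ∇ (fun w => fhat w y ξ) x ∂P = ∇ (fun w => f w y) x
  mean_grad_y : ∀ x ∈ enlarge X, ∀ y ∈ enlarge Y,
    Integrable (fun ξ => ∇ (fun w => fhat x w ξ) y) P ∧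
      ∫ ξ, ∇ (fun w => fhat x w ξ) y ∂P = ∇ (fun w => f x w) y
  var_grad_x : ∀ x ∈ enlarge X, ∀ y ∈ enlarge Y,
    Integrable (fun ξ => ‖∇ (fun w => fhat w y ξ) x - ∇ (fun w => f w y) x‖ ^ 2) P ∧
      ∫ ξ, ‖∇ (fun w => fhat w y ξ) x - ∇ (fun w => f w y) x‖ ^ 2 ∂P ≤ σ ^ 2
  var_grad_y : ∀ x ∈ enlarge X, ∀ y ∈ enlarge Y,
    Integrable (fun ξ => ‖∇ (fun w => fhat x w ξ) y - ∇ (fun w => f x w) y‖ ^ 2) P ∧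
      ∫ ξ, ‖∇ (fun w => fhat x w ξ) y - ∇ (fun w => f x w) y‖ ^ 2 ∂P ≤ σ ^ 2

/-- `z` is a saddle point of `f` on `X × Y`, i.e. a solution of `min_X max_Y f`. -/
def IsSolution {n m : ℕ} (X : Set (E n)) (Y : Set (E m)) (f : E n → E m → ℝ)
    (z : Pt n m) : Prop :=
  z ∈ feasible X Y ∧ IsSaddlePointOn X Y f z.fst z.snd

/-- One random sample `(ξ, u, v)`. -/
abbrev Sample (Ξ : Type*) (n m : ℕ) : Type _ := Ξ × E n × E m

/-- The stochastic zeroth-order gradient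
`((n/ρx) (fhat(x + ρx u, y, ξ) - fhat(x, y, ξ)) u, -(m/ρy) (fhat(x, y + ρy v, ξ) - fhat(x, y, ξ)) v)`
at `z = (x, y)`. -/
def zoGrad {n m : ℕ} {Ξ : Type*} (fhat : E n → E m → Ξ → ℝ) (ρx ρy : ℝ) (z : Pt n m)
    (s : Sample Ξ n m) : Pt n m :=
  WithLp.toLp 2
    (((n : ℝ) / ρx * (fhat (z.fst + ρx • s.2.1) z.snd s.1 - fhat z.fst z.snd s.1)) • s.2.1,
     -(((m : ℝ) / ρy * (fhat z.fst (z.snd + ρy • s.2.2) s.1 - fhat z.fst z.snd s.1)) • s.2.2))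

/-- The average of the zeroth-order gradients at `z` over a batch of `t` samples. -/
def batchGrad {n m : ℕ} {Ξ : Type*} (fhat : E n → E m → Ξ → ℝ) (ρx ρy : ℝ) (t : ℕ)
    (s : ℕ → Sample Ξ n m) (z : Pt n m) : Pt n m :=
  (t : ℝ)⁻¹ • ∑ i ∈ range t, zoGrad fhat ρx ρy z (s i)

/-- The parameters of the method; `t k` and `tHalf k` are the batch sizes `t_k`, `t_{k+0.5}`. -/
structure Params where
  (α β γ η τ ρx ρy : ℝ)
  (t tHalf : ℕ → ℕ)

/-- The stochastic zeroth-order extra-point method over the set `Z`, started at `z0`, along a given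
array of samples: `S (2 * k) i` and `S (2 * k + 1) i` are the `i`-th samples of the batches `k` and
`k + 0.5`. The value at `k` is the triple `(z^k, z^{k-1}, g^{k-1})`, where `g^k` is the batch
gradient at `z^k`; the momentum terms are absent in the first step, i.e. `z^{-1} = z^0` and
`g^{-1} = g^0`. -/
def run {n m : ℕ} {Ξ : Type*} (Z : Set (Pt n m)) (fhat : E n → E m → Ξ → ℝ) (p : Params)
    (z0 : Pt n m) (S : ℕ → ℕ → Sample Ξ n m) : ℕ → Pt n m × Pt n m × Pt n m
  | 0 => (z0, z0, batchGrad fhat p.ρx p.ρy (p.t 0) (S 0) z0)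
  | k + 1 =>
    let prev := run Z fhat p z0 S k
    let z := prev.1
    let zOld := prev.2.1
    let gOld := prev.2.2
    let g := batchGrad fhat p.ρx p.ρy (p.t k) (S (2 * k)) z
    let zHalf := proj Z (z + p.β • (z - zOld) - p.η • g)
    let gHalf := batchGrad fhat p.ρx p.ρy (p.tHalf k) (S (2 * k + 1)) zHalf
    (proj Z (z - p.α • gHalf + p.γ • (z - zOld) - p.τ • (g - gOld)), z, g)

/-- The iterate `z^k`. -/
def iterate {n m : ℕ} {Ξ : Type*} (Z : Set (Pt n m)) (fhat : E n → E m → Ξ → ℝ) (p : Params)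
    (z0 : Pt n m) (S : ℕ → ℕ → Sample Ξ n m) (k : ℕ) : Pt n m :=
  (run Z fhat p z0 S k).1

/-- The batch size `⌈K (1 - 1/(256κ))^{-(k+1)}⌉`. -/
def batchSize (κ : ℝ) (K k : ℕ) : ℕ :=
  ⌈(K : ℝ) * (1 - 1 / (256 * κ)) ^ (-((k : ℤ) + 1))⌉₊

/-- The parameter choice for `K` iterations. -/
def params (n m : ℕ) (L κ : ℝ) (K : ℕ) : Params where
  α := 1 / (4 * L)
  β := 1 / (64 * κ)
  γ := 1 / (64 * κ)
  η := 1 / (4 * L)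
  τ := 1 / (64 * L * κ)
  ρx := 1 / (Real.sqrt 2 * n * κ) * (1 - 1 / (256 * κ)) ^ K
  ρy := 1 / (Real.sqrt 2 * m * κ) * (1 - 1 / (256 * κ)) ^ K
  t := batchSize κ K
  tHalf := batchSize κ K

/-- The total number of samples used in `K` iterations, `∑_{k<K} (t_k + t_{k+0.5})`. -/
def totalSamples (p : Params) (K : ℕ) : ℕ := ∑ k ∈ range K, (p.t k + p.tHalf k)

/-- The random samples `S h i` are independent, each with `ξ`, `u`, `v` independent, `ξ` of law `P`,
and `u`, `v` uniform on the unit spheres. -/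
structure IsSampling {n m : ℕ} {Ξ Ω : Type*} [MeasurableSpace Ξ] [MeasurableSpace Ω]
    (P : Measure Ξ) (Pr : Measure Ω) (S : ℕ → ℕ → Ω → Sample Ξ n m) : Prop where
  measurable : ∀ h i, Measurable (S h i)
  law : ∀ h i, Pr.map (S h i) = P.prod ((uniformSphere n).prod (uniformSphere m))
  indep : iIndepFun (fun q : ℕ × ℕ => S q.1 q.2) Pr

end SZO

end

/-!
The method is an inexact extra-point method for the variational inequality of the operator
`F(z) = (∇ₓ f, -∇_y f)`, which is `L`-Lipschitz on `𝒵` and satisfies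
`⟨F z, z - z*⟩ ≥ μ ‖z - z*‖²` there, by strong convexity-concavity and the saddle point property.

*Contraction.* The variational inequalities of the two projections in an iteration show
(`energy_step`) that the energy
`(1 - 1/(32κ)) ‖z^k - z*‖² + ‖z^k - z^{k-1}‖² / 8` is multiplied by at most `q = 1 - 1/(256κ)`, up
to the squared errors of the three batch gradients involved and the term
`-⟨error at z^{k+0.5}, z^{k+0.5} - z*⟩ / (2L)`, whose mean only sees the bias of the estimator.

*The estimator.* The second moments of the uniform distribution on the sphere are those of the
identity divided by `n`, because reflections act transitively on directions. With a first-order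
Taylor expansion this bounds the bias by `n L ρ`
(`IsSmoothOracle.norm_integral_sphereGrad_sub_le`). The second moment stays bounded as `ρ → 0`,
because the finite difference of the oracle is the integral of a directional derivative with
bounded second moment (`IsSmoothOracle.lintegral_sub_sq_le`).

*Independence.* Each batch is independent of the point at which it is used, so that the law of the
two together is a product. Hence a batch average of size `t` has mean square error at most
`v / t + b²`, where `b` bounds the bias and `v` the second moment of the error of one sample
(`batchAvg_sq_le`).

*Summation.* The radii make `b = O(q^K / κ)` and the batch sizes make `v / t_k = O(q^(k+1) / K)`.
Both errors therefore add up to `O(q^K)` over the `K` iterations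
(`IsNoisyOracle.integral_energy_le`), with a constant `c` that does not involve
`μ`. The number of iterations is the least `K` with `c q^K ≤ ε` (`exists_iterations`).
-/

noncomputable section

namespace SZO

/-! ### Projection onto a closed convex set -/

section Projection
variable {V : Type*} [NormedAddCommGroup V] [InnerProductSpace ℝ V] [CompleteSpace V] {Z : Set V}

theorem isNearest_proj (hne : Z.Nonempty) (hc : IsClosed Z) (hconv : Convex ℝ Z) (z : V) :
    IsNearest Z z (proj Z z) := by
  have h : ∃ p, IsNearest Z z p := by
    obtain ⟨p, hp, hpz⟩ := exists_norm_eq_iInf_of_complete_convex hne hc.isComplete hconv z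
    refine ⟨p, hp, fun q hq => ?_⟩
    rw [hpz]
    exact ciInf_le ⟨0, by rintro _ ⟨w, rfl⟩; positivity⟩ (⟨q, hq⟩ : Z)
  rw [proj, dif_pos h]
  exact h.choose_spec

theorem proj_mem (hne : Z.Nonempty) (hc : IsClosed Z) (hconv : Convex ℝ Z) (z : V) :
    proj Z z ∈ Z := (isNearest_proj hne hc hconv z).1

/-- The variational characterization of the nearest point. -/
theorem inner_sub_proj_le_zero (hne : Z.Nonempty) (hc : IsClosed Z) (hconv : Convex ℝ Z) (z : V)
    {q : V} (hq : q ∈ Z) : inner ℝ (z - proj Z z) (q - proj Z z) ≤ 0 := by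
  obtain ⟨hp, hmin⟩ := isNearest_proj hne hc hconv z
  refine (norm_eq_iInf_iff_real_inner_le_zero hconv hp).1 ?_ q hq
  have : Nonempty Z := ⟨⟨_, hp⟩⟩
  exact le_antisymm (le_ciInf fun w => hmin w w.2)
    (ciInf_le ⟨0, by rintro _ ⟨w, rfl⟩; positivity⟩ (⟨_, hp⟩ : Z))

theorem proj_eq_self (hne : Z.Nonempty) (hc : IsClosed Z) (hconv : Convex ℝ Z) {z : V}
    (hz : z ∈ Z) : proj Z z = z := by
  have := (isNearest_proj hne hc hconv z).2 z hz
  rw [sub_self, norm_zero, norm_le_zero_iff, sub_eq_zero] at this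
  exact this.symm

theorem lipschitzWith_proj (hne : Z.Nonempty) (hc : IsClosed Z) (hconv : Convex ℝ Z) :
    LipschitzWith 1 (proj Z) := by
  refine LipschitzWith.of_dist_le_mul fun a b => ?_
  rw [dist_eq_norm, dist_eq_norm, NNReal.coe_one, one_mul]
  have h1 := inner_sub_proj_le_zero hne hc hconv a (proj_mem hne hc hconv b)
  have h2 := inner_sub_proj_le_zero hne hc hconv b (proj_mem hne hc hconv a)
  have h3 : ‖proj Z a - proj Z b‖ ^ 2 ≤ ‖a - b‖ * ‖proj Z a - proj Z b‖ := by
    refine le_trans ?_ (real_inner_le_norm _ _)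
    rw [← real_inner_self_eq_norm_sq]
    simp only [inner_sub_left, inner_sub_right] at h1 h2 ⊢
    rw [real_inner_comm (proj Z a) (proj Z b)] at *
    linarith
  by_contra! hlt
  nlinarith [norm_nonneg (a - b)]

end Projection

/-! ### One step of the inexact extra-point method -/

section Step

section
variable {V : Type*} [NormedAddCommGroup V]

theorem norm_sub_sq_le_two (a b : V) : ‖a - b‖ ^ 2 ≤ 2 * ‖a‖ ^ 2 + 2 * ‖b‖ ^ 2 := by
  nlinarith [norm_sub_le a b, norm_nonneg (a - b), sq_nonneg (‖a‖ - ‖b‖), norm_nonneg a,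
    norm_nonneg b]

/-- The Lyapunov function of the method, at the iterate `z`, the previous iterate `zo` and the
solution `zs`. -/
def energy (κ : ℝ) (zs z zo : V) : ℝ :=
  (1 - 1 / (32 * κ)) * ‖z - zs‖ ^ 2 + 1 / 8 * ‖z - zo‖ ^ 2

theorem norm_sub_sq_le_energy {κ : ℝ} (hκ : 1 ≤ κ) (zs z zo : V) :
    ‖z - zs‖ ^ 2 ≤ 2 * energy κ zs z zo := by
  have : 1 / (32 * κ) ≤ 1 / 2 := by
    rw [div_le_div_iff₀ (by positivity) (by norm_num)]; linarith
  unfold energy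
  nlinarith [sq_nonneg ‖z - zs‖, sq_nonneg ‖z - zo‖]

end

variable {V : Type*} [NormedAddCommGroup V] [InnerProductSpace ℝ V]

theorem two_inner_le (c : ℝ) (hc : 0 < c) (a b : V) :
    2 * inner ℝ a b ≤ c * ‖a‖ ^ 2 + c⁻¹ * ‖b‖ ^ 2 := by
  have h := real_inner_le_norm a b
  have h2 : 0 ≤ c⁻¹ * (c * ‖a‖ - ‖b‖) ^ 2 := by positivity
  have h3 : c⁻¹ * (c * ‖a‖ - ‖b‖) ^ 2 = c * ‖a‖ ^ 2 - 2 * (‖a‖ * ‖b‖) + c⁻¹ * ‖b‖ ^ 2 := by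
    field_simp
    ring
  linarith

/-- The two projection inequalities of an extra-point step, combined. -/
theorem extraPoint_basic {α γ τ : ℝ} {z zo zs w z' g go h : V}
    (hw : inner ℝ (z + γ • (z - zo) - α • g - w) (z' - w) ≤ 0)
    (hz' : inner ℝ (z - α • h + γ • (z - zo) - τ • (g - go) - z') (zs - z') ≤ 0) :
    ‖z' - zs‖ ^ 2 ≤ ‖z - zs‖ ^ 2 - ‖w - z'‖ ^ 2 - ‖w - z‖ ^ 2
      + γ * (2 * inner ℝ (z - zo) (w - zs)) - 2 * α * inner ℝ h (w - zs)
      + 2 * α * inner ℝ (h - g) (w - z') - 2 * τ * inner ℝ (g - go) (z' - zs) := by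
  simp only [← real_inner_self_eq_norm_sq, inner_sub_left, inner_sub_right, inner_add_left,
    inner_smul_left, RCLike.conj_to_real] at *
  rw [real_inner_comm zs z', real_inner_comm zs z, real_inner_comm w z', real_inner_comm w z] at *
  rw [real_inner_comm z' z] at *
  linarith

/-- One step of the extra-point method with inexact operator values `g ≈ F z`, `go ≈ F zo`,
`h ≈ F w` contracts the energy up to the errors of these values. The error of `h` enters to first
order only through its inner product with `w - zs`, so that only its bias matters there. -/
theorem energy_step {L κ : ℝ} (hL : 0 < L) (hκ : 1 ≤ κ) {z zo zs w z' g go h Fz Fzo Fw : V}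
    (hw : inner ℝ (z + (1 / (64 * κ)) • (z - zo) - (1 / (4 * L)) • g - w) (z' - w) ≤ 0)
    (hz' : inner ℝ (z - (1 / (4 * L)) • h + (1 / (64 * κ)) • (z - zo)
      - (1 / (64 * L * κ)) • (g - go) - z') (zs - z') ≤ 0)
    (hmono : L / κ * ‖w - zs‖ ^ 2 ≤ inner ℝ Fw (w - zs))
    (hlip : ‖Fw - Fz‖ ≤ L * ‖w - z‖) (hlip' : ‖Fz - Fzo‖ ≤ L * ‖z - zo‖) :
    energy κ zs z' z ≤ (1 - 1 / (256 * κ)) * energy κ zs z zo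
      + (-(1 / (2 * L)) * inner ℝ (h - Fw) (w - zs)
        + 1 / L ^ 2 * (‖h - Fw‖ ^ 2 + ‖g - Fz‖ ^ 2 + ‖go - Fzo‖ ^ 2)) := by
  have key := extraPoint_basic hw hz'
  have hκ0 : 0 < κ := by linarith
  -- with `k = 1 / κ` and `l = 1 / L` everything becomes polynomial
  obtain ⟨k, hk⟩ : ∃ k, k = 1 / κ := ⟨_, rfl⟩
  obtain ⟨l, hl⟩ : ∃ l, l = 1 / L := ⟨_, rfl⟩
  have hk0 : 0 < k := by rw [hk]; positivity
  have hl0 : 0 < l := by rw [hl]; positivity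
  have hk1 : k ≤ 1 := by rw [hk, div_le_one hκ0]; exact hκ
  have hlL : l * L = 1 := by rw [hl]; field_simp
  have e1 : 1 / (64 * κ) = k / 64 := by rw [hk]; field_simp
  have e2 : 1 / (4 * L) = l / 4 := by rw [hl]; field_simp
  have e3 : 1 / (64 * L * κ) = l * k / 64 := by rw [hl, hk]; field_simp
  have e4 : 1 / (256 * κ) = k / 256 := by rw [hk]; field_simp
  have e5 : 1 / (2 * L) = l / 2 := by rw [hl]; field_simp
  have e6 : 1 / L ^ 2 = l ^ 2 := by rw [hl]; field_simp
  have e7 : 1 / (32 * κ) = k / 32 := by rw [hk]; field_simp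
  have e8 : L / κ = L * k := by rw [hk]; field_simp
  unfold energy
  rw [e1, e2, e3] at key
  rw [e4, e5, e6, e7]
  rw [e8] at hmono
  -- the momentum term
  have b1 := two_inner_le 1 one_pos (z - zo) (w - zs)
  -- strong monotonicity
  have b2 : l * inner ℝ h (w - zs) ≥ k * ‖w - zs‖ ^ 2 + l * inner ℝ (h - Fw) (w - zs) := by
    have h1 : inner ℝ h (w - zs) = inner ℝ Fw (w - zs) + inner ℝ (h - Fw) (w - zs) := by
      rw [inner_sub_left h]; ring
    have h2 := mul_le_mul_of_nonneg_left hmono hl0.le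
    rw [h1, mul_add]
    have h3 : l * (L * k * ‖w - zs‖ ^ 2) = k * ‖w - zs‖ ^ 2 := by
      rw [← mul_assoc, ← mul_assoc, hlL, one_mul]
    linarith
  -- the extrapolation error
  have hdec : inner ℝ (h - g) (w - z') = inner ℝ (Fw - Fz) (w - z')
      + inner ℝ ((h - Fw) - (g - Fz)) (w - z') := by
    rw [← inner_add_left]; congr 1; abel
  have b3 : 2 * inner ℝ (Fw - Fz) (w - z') * l ≤ ‖w - z‖ ^ 2 + ‖w - z'‖ ^ 2 := by
    have h1 := two_inner_le l hl0 (Fw - Fz) (w - z')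
    have h2 : l ^ 2 * ‖Fw - Fz‖ ^ 2 ≤ ‖w - z‖ ^ 2 := by
      rw [← mul_pow]
      refine pow_le_pow_left₀ (by positivity) ?_ 2
      calc l * ‖Fw - Fz‖ ≤ l * (L * ‖w - z‖) := by gcongr
        _ = ‖w - z‖ := by rw [← mul_assoc, hlL, one_mul]
    have h3 := mul_le_mul_of_nonneg_right h1 hl0.le
    have h4 : (l * ‖Fw - Fz‖ ^ 2 + l⁻¹ * ‖w - z'‖ ^ 2) * l
      = l ^ 2 * ‖Fw - Fz‖ ^ 2 + ‖w - z'‖ ^ 2 := by field_simp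
    linarith
  have b4 : 2 * inner ℝ ((h - Fw) - (g - Fz)) (w - z') * l
      ≤ l ^ 2 * (2 * ‖h - Fw‖ ^ 2 + 2 * ‖g - Fz‖ ^ 2) + ‖w - z'‖ ^ 2 := by
    have h1 := two_inner_le l hl0 ((h - Fw) - (g - Fz)) (w - z')
    have h2 := mul_le_mul_of_nonneg_left (norm_sub_sq_le_two (h - Fw) (g - Fz)) (sq_nonneg l)
    have h3 := mul_le_mul_of_nonneg_right h1 hl0.le
    have h4 : (l * ‖(h - Fw) - (g - Fz)‖ ^ 2 + l⁻¹ * ‖w - z'‖ ^ 2) * l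
      = l ^ 2 * ‖(h - Fw) - (g - Fz)‖ ^ 2 + ‖w - z'‖ ^ 2 := by field_simp
    linarith
  -- the operator momentum term
  have hdec' : inner ℝ (g - go) (z' - zs) = inner ℝ (Fz - Fzo) (z' - zs)
      + inner ℝ ((g - Fz) - (go - Fzo)) (z' - zs) := by
    rw [← inner_add_left]; congr 1; abel
  have b5 : -(2 * inner ℝ (Fz - Fzo) (z' - zs) * l) ≤ ‖z - zo‖ ^ 2 + ‖z' - zs‖ ^ 2 := by
    have h1 := two_inner_le l hl0 (-(Fz - Fzo)) (z' - zs)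
    rw [inner_neg_left, norm_neg] at h1
    have h2 : l ^ 2 * ‖Fz - Fzo‖ ^ 2 ≤ ‖z - zo‖ ^ 2 := by
      rw [← mul_pow]
      refine pow_le_pow_left₀ (by positivity) ?_ 2
      calc l * ‖Fz - Fzo‖ ≤ l * (L * ‖z - zo‖) := by gcongr
        _ = ‖z - zo‖ := by rw [← mul_assoc, hlL, one_mul]
    have h3 := mul_le_mul_of_nonneg_right h1 hl0.le
    have h4 : (l * ‖Fz - Fzo‖ ^ 2 + l⁻¹ * ‖z' - zs‖ ^ 2) * l
      = l ^ 2 * ‖Fz - Fzo‖ ^ 2 + ‖z' - zs‖ ^ 2 := by field_simp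
    linarith
  have b6 : -(2 * inner ℝ ((g - Fz) - (go - Fzo)) (z' - zs) * l)
      ≤ l ^ 2 * (2 * ‖g - Fz‖ ^ 2 + 2 * ‖go - Fzo‖ ^ 2) + ‖z' - zs‖ ^ 2 := by
    have h1 := two_inner_le l hl0 (-((g - Fz) - (go - Fzo))) (z' - zs)
    rw [inner_neg_left, norm_neg] at h1
    have h2 := mul_le_mul_of_nonneg_left (norm_sub_sq_le_two (g - Fz) (go - Fzo)) (sq_nonneg l)
    have h3 := mul_le_mul_of_nonneg_right h1 hl0.le
    have h4 : (l * ‖(g - Fz) - (go - Fzo)‖ ^ 2 + l⁻¹ * ‖z' - zs‖ ^ 2) * l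
      = l ^ 2 * ‖(g - Fz) - (go - Fzo)‖ ^ 2 + ‖z' - zs‖ ^ 2 := by field_simp
    linarith
  -- the negative terms `-‖w - z'‖²`, `-‖w - z‖²` and `-k ‖w - zs‖²` pay for the momentum
  -- `‖z' - z‖²` of the next step and for the contraction of `‖z - zs‖²`
  have c1 : ‖z' - z‖ ^ 2 ≤ 2 * ‖w - z‖ ^ 2 + 2 * ‖w - z'‖ ^ 2 := by
    have := norm_sub_sq_le_two (w - z) (w - z')
    rwa [sub_sub_sub_cancel_left] at this
  have c2 : ‖z - zs‖ ^ 2 ≤ 2 * ‖w - zs‖ ^ 2 + 2 * ‖w - z‖ ^ 2 := by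
    have := norm_sub_sq_le_two (w - zs) (w - z)
    rwa [sub_sub_sub_cancel_left] at this
  rw [hdec, hdec'] at key
  have hE1 : 0 ≤ l ^ 2 * ‖h - Fw‖ ^ 2 := by positivity
  have hE2 : 0 ≤ l ^ 2 * ‖g - Fz‖ ^ 2 := by positivity
  have hE3 : 0 ≤ l ^ 2 * ‖go - Fzo‖ ^ 2 := by positivity
  have hA : 0 ≤ ‖w - z'‖ ^ 2 := by positivity
  have hB : 0 ≤ ‖w - z‖ ^ 2 := by positivity
  have hs : 0 ≤ ‖z - zo‖ ^ 2 := by positivity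
  have hd : 0 ≤ ‖z - zs‖ ^ 2 := by positivity
  have hW : 0 ≤ k * ‖w - zs‖ ^ 2 := by positivity
  have m1 := mul_le_mul_of_nonneg_left b1 hk0.le
  have m5 := mul_le_mul_of_nonneg_left b5 hk0.le
  have m6 := mul_le_mul_of_nonneg_left b6 hk0.le
  have mc2 := mul_le_mul_of_nonneg_left c2 hk0.le
  have mB := mul_le_mul_of_nonneg_right hk1 hB
  have ms := mul_le_mul_of_nonneg_right hk1 hs
  have m2 := mul_le_mul_of_nonneg_right hk1 hE2
  have m3 := mul_le_mul_of_nonneg_right hk1 hE3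
  have mk : 0 ≤ k ^ 2 * ‖z - zs‖ ^ 2 := by positivity
  have mk1 : 0 ≤ k * ‖z - zs‖ ^ 2 := by positivity
  have ms1 : 0 ≤ k * ‖z - zo‖ ^ 2 := by positivity
  have md1 : 0 ≤ k * ‖z' - zs‖ ^ 2 := by positivity
  linarith

end Step

/-! ### The uniform distribution on the sphere -/

section Sphere
open scoped Pointwise

variable {n : ℕ}

theorem map_toSphere_isometry (O : E n ≃ₗᵢ[ℝ] E n) :
    (((volume : Measure (E n)).toSphere).map Subtype.val).map O =
      ((volume : Measure (E n)).toSphere).map Subtype.val := by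
  have key : ∀ s : Set (E n), MeasurableSet s →
      ((volume : Measure (E n)).toSphere).map Subtype.val s =
        n * volume (Set.Ioo (0 : ℝ) 1 • (s ∩ Metric.sphere 0 1)) := by
    intro s hs
    rw [Measure.map_apply measurable_subtype_coe hs,
      Measure.toSphere_apply' _ (measurable_subtype_coe hs), Subtype.image_preimage_coe,
      finrank_euclideanSpace_fin, Set.inter_comm]
  ext s hs
  have hO : Measurable O := O.continuous.measurable
  rw [Measure.map_apply hO hs, key _ (hO hs), key _ hs]
  congr 1
  rw [← O.measurePreserving.measure_preimage_equiv (f := O.toMeasurableEquiv)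
    (Set.Ioo (0 : ℝ) 1 • (s ∩ Metric.sphere 0 1))]
  congr 1
  ext x
  simp only [Set.mem_smul, Set.mem_preimage, Set.mem_inter_iff, mem_sphere_zero_iff_norm]
  constructor
  · rintro ⟨r, hr, y, ⟨hy, hy1⟩, rfl⟩
    exact ⟨r, hr, O y, ⟨hy, by simpa using hy1⟩, by simp⟩
  · rintro ⟨r, hr, y, ⟨hy, hy1⟩, hxy⟩
    refine ⟨r, hr, O.symm y, ⟨by simpa using hy, by simpa using hy1⟩, ?_⟩
    apply O.injective
    simpa using hxy

theorem map_uniformSphere_isometry (O : E n ≃ₗᵢ[ℝ] E n) :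
    (uniformSphere n).map O = uniformSphere n := by
  rw [uniformSphere, Measure.map_smul, map_toSphere_isometry]

theorem isProbabilityMeasure_uniformSphere (hn : 1 ≤ n) :
    IsProbabilityMeasure (uniformSphere n) := by
  have : Nonempty (Fin n) := ⟨⟨0, hn⟩⟩
  have : Nontrivial (E n) := inferInstance
  refine ⟨?_⟩
  rw [uniformSphere, Measure.smul_apply, Measure.map_apply measurable_subtype_coe .univ,
    Set.preimage_univ, smul_eq_mul]
  refine ENNReal.inv_mul_cancel ?_ (measure_ne_top _ _)
  rw [Ne, Measure.measure_univ_eq_zero]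
  exact Measure.toSphere_ne_zero _

theorem ae_norm_eq_one_uniformSphere : ∀ᵐ u ∂(uniformSphere n), ‖u‖ = 1 := by
  have h : ∀ᵐ u ∂((volume : Measure (E n)).toSphere).map Subtype.val, ‖u‖ = 1 := by
    rw [ae_map_iff measurable_subtype_coe.aemeasurable
      (measurableSet_eq_fun measurable_norm measurable_const)]
    exact Filter.Eventually.of_forall fun u => by simp
  exact Measure.ae_smul_measure h _

theorem integrable_inner_mul_inner_uniformSphere (hn : 1 ≤ n) (a b : E n) :
    Integrable (fun u => inner ℝ a u * inner ℝ b u) (uniformSphere n) := by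
  have := isProbabilityMeasure_uniformSphere hn
  refine Integrable.of_bound (C := ‖a‖ * ‖b‖) (by fun_prop) ?_
  filter_upwards [ae_norm_eq_one_uniformSphere] with u hu
  have h1 := norm_inner_le_norm (𝕜 := ℝ) a u
  have h2 := norm_inner_le_norm (𝕜 := ℝ) b u
  rw [hu, mul_one] at h1 h2
  rw [norm_mul]
  gcongr

/-- Any two vectors of the same length are exchanged by a reflection, which preserves the uniform
distribution. -/
theorem integral_inner_sq_uniformSphere_congr {a b : E n} (hab : ‖a‖ = ‖b‖) :
    ∫ u, inner ℝ a u ^ 2 ∂(uniformSphere n) = ∫ u, inner ℝ b u ^ 2 ∂(uniformSphere n) := by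
  set O : E n ≃ₗᵢ[ℝ] E n := (Submodule.span ℝ {a - b})ᗮ.reflection
  have hO : O a = b := Submodule.reflection_sub hab
  conv_rhs => rw [← map_uniformSphere_isometry O]
  rw [integral_map O.continuous.measurable.aemeasurable (by fun_prop)]
  simp_rw [← hO, LinearIsometryEquiv.inner_map_map]

theorem integral_inner_sq_uniformSphere (hn : 1 ≤ n) (a : E n) :
    ∫ u, inner ℝ a u ^ 2 ∂(uniformSphere n) = ‖a‖ ^ 2 / n := by
  have := isProbabilityMeasure_uniformSphere hn
  have hunit : ∀ a : E n, ‖a‖ = 1 → ∫ u, inner ℝ a u ^ 2 ∂(uniformSphere n) = 1 / n := by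
    intro a ha
    have hsum : ∑ i : Fin n, ∫ u, inner ℝ (EuclideanSpace.basisFun (Fin n) ℝ i) u ^ 2
        ∂(uniformSphere n) = 1 := by
      rw [← integral_finsetSum]
      · rw [← integral_congr_ae (f := fun _ => (1 : ℝ))]
        · simp
        · filter_upwards [ae_norm_eq_one_uniformSphere] with u hu
          rw [OrthonormalBasis.sum_sq_inner_right, hu, one_pow]
      · intro i _
        simpa only [pow_two] using integrable_inner_mul_inner_uniformSphere hn _ _
    have hall : ∀ i : Fin n, ∫ u, inner ℝ (EuclideanSpace.basisFun (Fin n) ℝ i) u ^ 2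
        ∂(uniformSphere n) = ∫ u, inner ℝ a u ^ 2 ∂(uniformSphere n) := fun i =>
      integral_inner_sq_uniformSphere_congr (by rw [ha, OrthonormalBasis.norm_eq_one])
    rw [Finset.sum_congr rfl fun i _ => hall i, sum_const, card_univ, Fintype.card_fin,
      nsmul_eq_mul] at hsum
    rw [eq_div_iff (by positivity), mul_comm, hsum]
  rcases eq_or_ne a 0 with rfl | ha
  · simp
  have h := hunit (‖a‖⁻¹ • a) (norm_smul_inv_norm ha)
  simp_rw [real_inner_smul_left, mul_pow] at h
  rw [integral_const_mul] at h
  have : ‖a‖ ≠ 0 := norm_ne_zero_iff.2 ha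
  field_simp at h ⊢
  linarith

/-- The second moments of the uniform distribution on the sphere. -/
theorem integral_inner_mul_inner_uniformSphere (hn : 1 ≤ n) (a b : E n) :
    ∫ u, inner ℝ a u * inner ℝ b u ∂(uniformSphere n) = inner ℝ a b / n := by
  have h : ∀ u, inner ℝ a u * inner ℝ b u =
      (1 / 4 : ℝ) * (inner ℝ (a + b) u ^ 2 - inner ℝ (a - b) u ^ 2) := by
    intro u
    rw [inner_add_left, inner_sub_left]
    ring
  have hi : ∀ c : E n, Integrable (fun u => inner ℝ c u ^ 2) (uniformSphere n) := fun c => by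
    simpa only [pow_two] using integrable_inner_mul_inner_uniformSphere hn c c
  simp_rw [h]
  rw [integral_const_mul, integral_sub (hi _) (hi _), integral_inner_sq_uniformSphere hn,
    integral_inner_sq_uniformSphere hn, norm_add_sq_real, norm_sub_sq_real]
  ring

/-- For `u` uniform on the unit sphere, `n ⟨a, u⟩ u` has mean `a`. -/
theorem integral_inner_smul_uniformSphere (hn : 1 ≤ n) (a : E n) :
    Integrable (fun u => inner ℝ a u • u) (uniformSphere n) ∧
      ∫ u, inner ℝ a u • u ∂(uniformSphere n) = (1 / (n : ℝ)) • a := by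
  have := isProbabilityMeasure_uniformSphere hn
  have hint : Integrable (fun u => inner ℝ a u • u) (uniformSphere n) := by
    refine Integrable.of_bound (C := ‖a‖) (by fun_prop) ?_
    filter_upwards [ae_norm_eq_one_uniformSphere] with u hu
    have h1 := norm_inner_le_norm (𝕜 := ℝ) a u
    rw [norm_smul, hu, mul_one]
    simpa [hu] using h1
  refine ⟨hint, ext_inner_left ℝ fun b => ?_⟩
  rw [← integral_inner hint b]
  simp_rw [real_inner_smul_right]
  rw [integral_inner_mul_inner_uniformSphere hn, real_inner_comm]
  ring

end Sphere

/-! ### The gradient estimator in one variable -/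

section Smoothing
variable {n : ℕ} {Ξ : Type*} [MeasurableSpace Ξ]

/-- The stochastic function `φ x ξ` has mean `c x`, and on `U` it has gradients within variance `σ²`
of those of `c`, which are `ℓ`-Lipschitz. This is what the hypotheses on the oracle say about each
of the two variables when the other one is fixed. -/
structure IsSmoothOracle (P : Measure Ξ) (U : Set (E n)) (c : E n → ℝ) (φ : E n → Ξ → ℝ)
    (σ ℓ : ℝ) : Prop where
  measurable : Measurable (fun p : E n × Ξ => φ p.1 p.2)
  diff : ∀ x ∈ U, ∀ ξ, DifferentiableAt ℝ (fun w => φ w ξ) x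
  diff_mean : ∀ x ∈ U, DifferentiableAt ℝ c x
  lip : ∀ x ∈ U, ∀ x' ∈ U, ‖∇ c x - ∇ c x'‖ ≤ ℓ * ‖x - x'‖
  mean : ∀ x ∈ U, Integrable (fun ξ => φ x ξ) P ∧ ∫ ξ, φ x ξ ∂P = c x
  var : ∀ x ∈ U, Integrable (fun ξ => ‖∇ (fun w => φ w ξ) x - ∇ c x‖ ^ 2) P ∧
      ∫ ξ, ‖∇ (fun w => φ w ξ) x - ∇ c x‖ ^ 2 ∂P ≤ σ ^ 2

/-- The derivative of a function along a line, in terms of the gradient. -/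
theorem hasDerivAt_line {g : E n → ℝ} {x u : E n} {ρ s : ℝ}
    (h : DifferentiableAt ℝ g (x + (s * ρ) • u)) :
    HasDerivAt (fun s : ℝ => g (x + (s * ρ) • u)) (ρ * inner ℝ (∇ g (x + (s * ρ) • u)) u) s := by
  have h1 : HasDerivAt (fun s : ℝ => x + (s * ρ) • u) (ρ • u) s := by
    have := ((hasDerivAt_id s).mul_const ρ).smul_const u
    simpa using this.const_add x
  have h2 := h.hasGradientAt.hasFDerivAt.comp_hasDerivAt s h1
  refine h2.congr_deriv ?_
  rw [InnerProductSpace.toDual_apply_apply, real_inner_smul_right]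

/-- A function on `[0, 1]` that is everywhere differentiable satisfies
`(ψ 1 - ψ 0)² ≤ ∫ (ψ')²`; the right side is allowed to be infinite. -/
theorem sq_sub_le_lintegral_deriv_sq {ψ : ℝ → ℝ} (h : ∀ s ∈ Set.Icc (0 : ℝ) 1,
    DifferentiableAt ℝ ψ s) :
    ENNReal.ofReal ((ψ 1 - ψ 0) ^ 2) ≤
      ∫⁻ s in Set.Icc (0 : ℝ) 1, ENNReal.ofReal (deriv ψ s ^ 2) := by
  by_cases htop : ∫⁻ s in Set.Icc (0 : ℝ) 1, ENNReal.ofReal (deriv ψ s ^ 2) = ⊤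
  · rw [htop]; exact le_top
  have : IsProbabilityMeasure (volume.restrict (Set.Icc (0 : ℝ) 1)) := ⟨by simp⟩
  have hmeas : Measurable (deriv ψ) := measurable_deriv ψ
  have hsq : Integrable (fun s => deriv ψ s ^ 2) (volume.restrict (Set.Icc (0 : ℝ) 1)) := by
    refine ⟨by fun_prop, ?_⟩
    rw [hasFiniteIntegral_iff_ofReal (Filter.Eventually.of_forall fun s => sq_nonneg _)]
    exact lt_top_iff_ne_top.2 htop
  have hmem : MemLp (deriv ψ) 2 (volume.restrict (Set.Icc (0 : ℝ) 1)) :=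
    (memLp_two_iff_integrable_sq hmeas.aestronglyMeasurable).2 hsq
  have hint : Integrable (deriv ψ) (volume.restrict (Set.Icc (0 : ℝ) 1)) :=
    hmem.integrable one_le_two
  have hftc : ∫ s in Set.Icc (0 : ℝ) 1, deriv ψ s = ψ 1 - ψ 0 := by
    rw [integral_Icc_eq_integral_Ioc, ← intervalIntegral.integral_of_le zero_le_one]
    refine intervalIntegral.integral_eq_sub_of_hasDerivAt (fun s hs => ?_) ?_
    · rw [Set.uIcc_of_le zero_le_one] at hs
      exact (h s hs).hasDerivAt
    · rw [intervalIntegrable_iff_integrableOn_Icc_of_le zero_le_one]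
      exact hint
  rw [← ofReal_integral_eq_lintegral_ofReal hsq
    (Filter.Eventually.of_forall fun s => sq_nonneg _)]
  apply ENNReal.ofReal_le_ofReal
  have h0 : 0 ≤ ∫ s in Set.Icc (0 : ℝ) 1, (deriv ψ s - (ψ 1 - ψ 0)) ^ 2 :=
    integral_nonneg fun s => sq_nonneg _
  have h1 : ∀ s, (deriv ψ s - (ψ 1 - ψ 0)) ^ 2 =
      deriv ψ s ^ 2 - 2 * (ψ 1 - ψ 0) * deriv ψ s + (ψ 1 - ψ 0) ^ 2 := fun s => by ring
  simp_rw [h1] at h0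
  have hsub : Integrable (fun s => deriv ψ s ^ 2 - 2 * (ψ 1 - ψ 0) * deriv ψ s)
      (volume.restrict (Set.Icc (0 : ℝ) 1)) := hsq.sub (hint.const_mul _)
  rw [integral_add hsub (integrable_const _),
    integral_sub hsq (hint.const_mul _), integral_const_mul, hftc] at h0
  simp only [integral_const, probReal_univ, smul_eq_mul, one_mul] at h0
  linarith

variable {P : Measure Ξ} {U : Set (E n)} {c : E n → ℝ}
  {φ : E n → Ξ → ℝ} {σ ℓ M ρ : ℝ} {x u : E n}

/-- First-order Taylor expansion of the mean. -/
theorem IsSmoothOracle.abs_taylor_le (H : IsSmoothOracle P U c φ σ ℓ) (hℓ : 0 ≤ ℓ) (hρ : 0 ≤ ρ)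
    (hU : ∀ s ∈ Set.Icc (0 : ℝ) 1, x + (s * ρ) • u ∈ U) (hu : ‖u‖ = 1) :
    |c (x + ρ • u) - c x - ρ * inner ℝ (∇ c x) u| ≤ ℓ * ρ ^ 2 := by
  have hx : x ∈ U := by simpa using hU 0 (by simp)
  have hd : ∀ s ∈ Set.Icc (0 : ℝ) 1, HasDerivWithinAt
      (fun s : ℝ => c (x + (s * ρ) • u) - s * (ρ * inner ℝ (∇ c x) u))
      (ρ * inner ℝ (∇ c (x + (s * ρ) • u)) u - ρ * inner ℝ (∇ c x) u) (Set.Icc 0 1) s :=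
    fun s hs => by
      have := (hasDerivAt_line (H.diff_mean _ (hU s hs))).sub
        ((hasDerivAt_id s).mul_const (ρ * inner ℝ (∇ c x) u))
      rw [one_mul] at this
      exact this.hasDerivWithinAt
  have hb : ∀ s ∈ Set.Icc (0 : ℝ) 1,
      ‖ρ * inner ℝ (∇ c (x + (s * ρ) • u)) u - ρ * inner ℝ (∇ c x) u‖ ≤ ℓ * ρ ^ 2 := by
    intro s hs
    rw [← mul_sub, ← inner_sub_left, norm_mul, Real.norm_of_nonneg hρ]
    have h1 := norm_inner_le_norm (𝕜 := ℝ) (∇ c (x + (s * ρ) • u) - ∇ c x) u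
    have h2 := H.lip _ (hU s hs) _ hx
    rw [add_sub_cancel_left, norm_smul, hu, mul_one,
      Real.norm_of_nonneg (mul_nonneg hs.1 hρ)] at h2
    rw [hu, mul_one] at h1
    have h3 : s * ρ ≤ ρ := mul_le_of_le_one_left hρ hs.2
    calc _ ≤ ρ * (ℓ * ρ) := by
          gcongr
          exact h1.trans (h2.trans (by gcongr))
      _ = ℓ * ρ ^ 2 := by ring
  have := (convex_Icc (0 : ℝ) 1).norm_image_sub_le_of_norm_hasDerivWithin_le hd hb
    (Set.left_mem_Icc.2 zero_le_one) (Set.right_mem_Icc.2 zero_le_one)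
  simpa [sub_right_comm] using this

/-- The one-point-difference estimator of the gradient of `c` at `x`. -/
def sphereGrad (φ : E n → Ξ → ℝ) (ρ : ℝ) (x : E n) (p : Ξ × E n) : E n :=
  ((n : ℝ) / ρ * (φ (x + ρ • p.2) p.1 - φ x p.1)) • p.2

theorem IsSmoothOracle.measurable_sphereGrad (H : IsSmoothOracle P U c φ σ ℓ) :
    Measurable (sphereGrad φ ρ x) := by
  have h1 : Measurable (fun p : Ξ × E n => ((x + ρ • p.2, p.1) : E n × Ξ)) := by fun_prop
  have h2 : Measurable (fun p : Ξ × E n => ((x, p.1) : E n × Ξ)) := by fun_prop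
  exact (((H.measurable.comp h1).sub (H.measurable.comp h2)).const_mul _).smul measurable_snd

variable [IsProbabilityMeasure P]

theorem IsSmoothOracle.lintegral_inner_gradient_sq_le (H : IsSmoothOracle P U c φ σ ℓ) (hx : x ∈ U)
    (hM : ‖∇ c x‖ ≤ M) (hu : ‖u‖ = 1) :
    ∫⁻ ξ, ENNReal.ofReal ((ρ * inner ℝ (∇ (fun w => φ w ξ) x) u) ^ 2) ∂P ≤
      ENNReal.ofReal (ρ ^ 2 * (2 * (σ ^ 2 + M ^ 2))) := by
  obtain ⟨hi, hv⟩ := H.var x hx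
  have hpt : ∀ ξ, (ρ * inner ℝ (∇ (fun w => φ w ξ) x) u) ^ 2 ≤
      ρ ^ 2 * (2 * ‖∇ (fun w => φ w ξ) x - ∇ c x‖ ^ 2 + 2 * M ^ 2) := by
    intro ξ
    set a := ∇ (fun w => φ w ξ) x
    have h1 : inner ℝ a u ^ 2 ≤ ‖a‖ ^ 2 := by
      have := abs_real_inner_le_norm a u
      rw [hu, mul_one] at this
      exact sq_le_sq' (neg_le_of_abs_le this) (le_of_abs_le this)
    have h2 := norm_sub_sq_le_two (a - ∇ c x) (-∇ c x)
    rw [sub_neg_eq_add, sub_add_cancel, norm_neg] at h2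
    have h3 : ‖∇ c x‖ ^ 2 ≤ M ^ 2 := by gcongr
    rw [mul_pow]
    gcongr
    linarith
  refine (lintegral_mono fun ξ => ENNReal.ofReal_le_ofReal (hpt ξ)).trans ?_
  have hadd : Integrable (fun ξ => 2 * ‖∇ (fun w => φ w ξ) x - ∇ c x‖ ^ 2 + 2 * M ^ 2) P :=
    (hi.const_mul 2).add (integrable_const _)
  rw [← ofReal_integral_eq_lintegral_ofReal (hadd.const_mul _)
    (Filter.Eventually.of_forall fun ξ => by positivity), integral_const_mul,
    integral_add (hi.const_mul 2) (integrable_const _), integral_const_mul]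
  simp only [integral_const, probReal_univ, smul_eq_mul, one_mul]
  apply ENNReal.ofReal_le_ofReal
  gcongr
  linarith

/-- A finite difference of the oracle of length `ρ` has second moment `O(ρ²)`. The oracle is only
differentiable pointwise, so that the finite difference is the integral of the directional
derivative only for those `ξ` for which this derivative is integrable over the segment; by Tonelli
and the variance bound these are almost all `ξ`. -/
theorem IsSmoothOracle.lintegral_sub_sq_le (H : IsSmoothOracle P U c φ σ ℓ)
    (hU : ∀ s ∈ Set.Icc (0 : ℝ) 1, x + (s * ρ) • u ∈ U)
    (hM : ∀ s ∈ Set.Icc (0 : ℝ) 1, ‖∇ c (x + (s * ρ) • u)‖ ≤ M) (hu : ‖u‖ = 1) :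
    ∫⁻ ξ, ENNReal.ofReal ((φ (x + ρ • u) ξ - φ x ξ) ^ 2) ∂P ≤
      ENNReal.ofReal (ρ ^ 2 * (2 * (σ ^ 2 + M ^ 2))) := by
  set ν : Measure ℝ := volume.restrict (Set.Icc (0 : ℝ) 1)
  have : IsProbabilityMeasure ν := ⟨by simp [ν]⟩
  set ψ : Ξ → ℝ → ℝ := fun ξ s => φ (x + (s * ρ) • u) ξ with hψ
  have hψm : Measurable (fun p : ℝ × Ξ => ψ p.2 p.1) := by
    have : Measurable (fun p : ℝ × Ξ => ((x + (p.1 * ρ) • u, p.2) : E n × Ξ)) := by fun_prop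
    exact H.measurable.comp this
  have hderiv : ∀ ξ, ∀ s ∈ Set.Icc (0 : ℝ) 1, HasDerivAt (ψ ξ)
      (ρ * inner ℝ (∇ (fun w => φ w ξ) (x + (s * ρ) • u)) u) s := fun ξ s hs =>
    hasDerivAt_line (g := fun w => φ w ξ) (H.diff _ (hU s hs) ξ)
  have hmem : ∀ᵐ p ∂(ν.prod P), p.1 ∈ Set.Icc (0 : ℝ) 1 :=
    (measurePreserving_fst (μ := ν) (ν := P)).quasiMeasurePreserving.ae
      (ae_restrict_mem measurableSet_Icc)
  -- the derivative is a limit of measurable difference quotients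
  have hDm : AEMeasurable (fun p : ℝ × Ξ => deriv (ψ p.2) p.1) (ν.prod P) := by
    refine aemeasurable_of_tendsto_metrizable_ae (u := Filter.atTop)
      (f := fun (k : ℕ) (p : ℝ × Ξ) =>
        (1 / ((k : ℝ) + 1))⁻¹ • (ψ p.2 (p.1 + 1 / ((k : ℝ) + 1)) - ψ p.2 p.1)) (fun k => ?_) ?_
    · have h1 : Measurable (fun p : ℝ × Ξ => ((p.1 + 1 / ((k : ℝ) + 1), p.2) : ℝ × Ξ)) := by
        fun_prop
      exact (((hψm.comp h1).sub hψm).const_smul (1 / ((k : ℝ) + 1))⁻¹).aemeasurable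
    · filter_upwards [hmem] with p hp
      have h1 := (hderiv p.2 p.1 hp).differentiableAt.hasDerivAt
      rw [hasDerivAt_iff_tendsto_slope_zero] at h1
      refine h1.comp (tendsto_nhdsWithin_iff.2 ⟨tendsto_one_div_add_atTop_nhds_zero_nat, ?_⟩)
      exact Filter.Eventually.of_forall fun k => by
        have : (0 : ℝ) < 1 / ((k : ℝ) + 1) := by positivity
        exact this.ne'
  calc ∫⁻ ξ, ENNReal.ofReal ((φ (x + ρ • u) ξ - φ x ξ) ^ 2) ∂P
      ≤ ∫⁻ ξ, ∫⁻ s, ENNReal.ofReal (deriv (ψ ξ) s ^ 2) ∂ν ∂P := by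
        refine lintegral_mono fun ξ => ?_
        have := sq_sub_le_lintegral_deriv_sq (ψ := ψ ξ)
          fun s hs => (hderiv ξ s hs).differentiableAt
        simpa [hψ] using this
    _ = ∫⁻ s, ∫⁻ ξ, ENNReal.ofReal (deriv (ψ ξ) s ^ 2) ∂P ∂ν := by
        refine (lintegral_lintegral_swap
          (f := fun s ξ => ENNReal.ofReal (deriv (ψ ξ) s ^ 2)) ?_).symm
        exact (hDm.pow_const 2).ennreal_ofReal
    _ ≤ ∫⁻ s, ENNReal.ofReal (ρ ^ 2 * (2 * (σ ^ 2 + M ^ 2))) ∂ν := by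
        refine lintegral_mono_ae ?_
        filter_upwards [ae_restrict_mem measurableSet_Icc] with s hs
        simp_rw [fun ξ => (hderiv ξ s hs).deriv]
        exact H.lintegral_inner_gradient_sq_le (hU s hs) (hM s hs) hu
    _ = _ := by simp

theorem IsSmoothOracle.sphereGrad_sq_le (H : IsSmoothOracle P U c φ σ ℓ) (hn : 1 ≤ n)
    (hℓ : 0 ≤ ℓ) (hρ : 0 < ρ) (hρ1 : ρ ≤ 1) (hM : ‖∇ c x‖ ≤ M)
    (hU : ∀ u : E n, ‖u‖ ≤ 1 → x + u ∈ U) :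
    Integrable (fun p => ‖sphereGrad φ ρ x p‖ ^ 2) (P.prod (uniformSphere n)) ∧
      ∫ p, ‖sphereGrad φ ρ x p‖ ^ 2 ∂(P.prod (uniformSphere n)) ≤
        n ^ 2 * (2 * (σ ^ 2 + (M + ℓ) ^ 2)) := by
  have := isProbabilityMeasure_uniformSphere hn
  have hm : Measurable (fun p => ‖sphereGrad φ ρ x p‖ ^ 2) :=
    H.measurable_sphereGrad.norm.pow_const 2
  have hx : x ∈ U := by simpa using hU 0 (by simp)
  have hseg : ∀ u : E n, ‖u‖ = 1 → ∀ s ∈ Set.Icc (0 : ℝ) 1, ‖(s * ρ) • u‖ ≤ 1 := by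
    intro u hu s hs
    rw [norm_smul, hu, mul_one, Real.norm_of_nonneg (mul_nonneg hs.1 hρ.le)]
    exact mul_le_one₀ hs.2 hρ.le hρ1
  have hgrad : ∀ u : E n, ‖u‖ ≤ 1 → ‖∇ c (x + u)‖ ≤ M + ℓ := by
    intro u hu
    have h1 := H.lip _ (hU u hu) _ hx
    rw [add_sub_cancel_left] at h1
    have h2 : ℓ * ‖u‖ ≤ ℓ := mul_le_of_le_one_right hℓ hu
    have h3 := norm_sub_norm_le (∇ c (x + u)) (∇ c x)
    linarith
  have hlin : ∫⁻ p, ENNReal.ofReal (‖sphereGrad φ ρ x p‖ ^ 2) ∂(P.prod (uniformSphere n)) ≤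
      ENNReal.ofReal (n ^ 2 * (2 * (σ ^ 2 + (M + ℓ) ^ 2))) := by
    rw [lintegral_prod_symm' _ hm.ennreal_ofReal]
    calc _ ≤ ∫⁻ u, ENNReal.ofReal (n ^ 2 * (2 * (σ ^ 2 + (M + ℓ) ^ 2)))
          ∂(uniformSphere n) := by
          refine lintegral_mono_ae ?_
          filter_upwards [ae_norm_eq_one_uniformSphere] with u hu
          have h1 := H.lintegral_sub_sq_le (fun s hs => hU _ (hseg u hu s hs))
            (fun s hs => hgrad _ (hseg u hu s hs)) hu
          have h2 : ∀ ξ, ENNReal.ofReal (‖sphereGrad φ ρ x (ξ, u)‖ ^ 2) =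
              ENNReal.ofReal ((n / ρ) ^ 2) *
                ENNReal.ofReal ((φ (x + ρ • u) ξ - φ x ξ) ^ 2) := by
            intro ξ
            rw [← ENNReal.ofReal_mul (by positivity), sphereGrad, norm_smul, hu, mul_one,
              Real.norm_eq_abs, sq_abs, mul_pow]
          simp_rw [h2]
          rw [lintegral_const_mul']
          · refine (mul_le_mul_right h1 _).trans_eq ?_
            rw [← ENNReal.ofReal_mul (by positivity)]
            congr 1
            field_simp
          · exact ENNReal.ofReal_ne_top
      _ = _ := by simp
  have hnn : 0 ≤ᵐ[P.prod (uniformSphere n)] fun p => ‖sphereGrad φ ρ x p‖ ^ 2 :=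
    Filter.Eventually.of_forall fun p => by positivity
  refine ⟨⟨hm.aestronglyMeasurable, ?_⟩, ?_⟩
  · rw [hasFiniteIntegral_iff_ofReal hnn]
    exact hlin.trans_lt ENNReal.ofReal_lt_top
  · rw [integral_eq_lintegral_of_nonneg_ae hnn hm.aestronglyMeasurable]
    exact ENNReal.toReal_le_of_le_ofReal (by positivity) hlin

theorem IsSmoothOracle.integrable_sphereGrad (H : IsSmoothOracle P U c φ σ ℓ) (hn : 1 ≤ n)
    (hℓ : 0 ≤ ℓ) (hρ : 0 < ρ) (hρ1 : ρ ≤ 1) (hM : ‖∇ c x‖ ≤ M)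
    (hU : ∀ u : E n, ‖u‖ ≤ 1 → x + u ∈ U) :
    Integrable (sphereGrad φ ρ x) (P.prod (uniformSphere n)) := by
  have := isProbabilityMeasure_uniformSphere hn
  exact ((memLp_two_iff_integrable_sq_norm H.measurable_sphereGrad.aestronglyMeasurable).2
    (H.sphereGrad_sq_le hn hℓ hρ hρ1 hM hU).1).integrable one_le_two

/-- The bias of the gradient estimator is at most `n ℓ ρ`. -/
theorem IsSmoothOracle.norm_integral_sphereGrad_sub_le (H : IsSmoothOracle P U c φ σ ℓ)
    (hn : 1 ≤ n) (hℓ : 0 ≤ ℓ) (hρ : 0 < ρ) (hρ1 : ρ ≤ 1) (hM : ‖∇ c x‖ ≤ M)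
    (hU : ∀ u : E n, ‖u‖ ≤ 1 → x + u ∈ U) :
    ‖∫ p, sphereGrad φ ρ x p ∂(P.prod (uniformSphere n)) - ∇ c x‖ ≤ n * ℓ * ρ := by
  have := isProbabilityMeasure_uniformSphere hn
  have hint := H.integrable_sphereGrad hn hℓ hρ hρ1 hM hU
  have hx : x ∈ U := by simpa using hU 0 (by simp)
  have hseg : ∀ u : E n, ‖u‖ = 1 → ∀ s ∈ Set.Icc (0 : ℝ) 1, ‖(s * ρ) • u‖ ≤ 1 := by
    intro u hu s hs
    rw [norm_smul, hu, mul_one, Real.norm_of_nonneg (mul_nonneg hs.1 hρ.le)]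
    exact mul_le_one₀ hs.2 hρ.le hρ1
  have hinner : ∀ u : E n, ‖u‖ = 1 → ∫ ξ, sphereGrad φ ρ x (ξ, u) ∂P =
      ((n : ℝ) / ρ * (c (x + ρ • u) - c x)) • u := by
    intro u hu
    have h1 := H.mean (x + ρ • u) (hU _ (by simpa using hseg u hu 1 (by simp)))
    have h2 := H.mean x hx
    simp only [sphereGrad]
    rw [integral_smul_const, integral_const_mul, integral_sub h1.1 h2.1, h1.2, h2.2]
  rw [integral_prod_symm _ hint]
  have h0 : (n : ℝ) ≠ 0 := by positivity
  have hgr : ∇ c x = ∫ u, (n : ℝ) • (inner ℝ (∇ c x) u • u) ∂(uniformSphere n) := by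
    rw [integral_smul, (integral_inner_smul_uniformSphere hn _).2, smul_smul,
      mul_one_div_cancel h0, one_smul]
  conv_lhs => rw [hgr]
  have hsm : Integrable (fun u => (n : ℝ) • (inner ℝ (∇ c x) u • u)) (uniformSphere n) :=
    (integral_inner_smul_uniformSphere hn _).1.smul (n : ℝ)
  rw [← integral_sub hint.integral_prod_right hsm]
  refine (norm_integral_le_of_norm_le_const (C := n * ℓ * ρ) ?_).trans_eq (by simp)
  filter_upwards [ae_norm_eq_one_uniformSphere] with u hu
  have h1 := H.abs_taylor_le hℓ hρ.le (fun s hs => hU _ (hseg u hu s hs)) hu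
  rw [hinner u hu, smul_smul, ← sub_smul, norm_smul, hu, mul_one]
  have h2 : (n : ℝ) / ρ * (c (x + ρ • u) - c x) - n * inner ℝ (∇ c x) u =
      n / ρ * (c (x + ρ • u) - c x - ρ * inner ℝ (∇ c x) u) := by
    field_simp
  rw [h2, norm_mul, Real.norm_of_nonneg (by positivity), Real.norm_eq_abs]
  calc _ ≤ n / ρ * (ℓ * ρ ^ 2) := by gcongr
    _ = n * ℓ * ρ := by field_simp

end Smoothing

/-! ### Strong convexity and gradients -/

section Operator

/-- `F(z) = (∇ₓ f, -∇_y f)`, the operator whose variational inequality describes the saddle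
points. -/
def gradOp {n m : ℕ} (f : E n → E m → ℝ) (z : Pt n m) : Pt n m :=
  WithLp.toLp 2 (∇ (fun w => f w z.snd) z.fst, -∇ (fun w => f z.fst w) z.snd)

theorem le_sub_of_forall_le_sub_mul {a b c : ℝ}
    (h : ∀ t ∈ Set.Ioo (0 : ℝ) 1, a ≤ b - (1 - t) * c) : a ≤ b - c := by
  have h1 : Filter.Tendsto (fun t : ℝ => b - (1 - t) * c) (nhdsWithin 0 (Set.Ioi 0))
      (nhds (b - (1 - 0) * c)) :=
    Continuous.continuousWithinAt (by fun_prop)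
  rw [sub_zero, one_mul] at h1
  refine ge_of_tendsto h1 ?_
  filter_upwards [Ioo_mem_nhdsGT (zero_lt_one' ℝ)] with t ht using h t ht

variable {n : ℕ} {X : Set (E n)} {μ : ℝ} {g : E n → ℝ} {x x' : E n}

theorem secant_le_of_strongConvexOn (hg : StrongConvexOn X μ g) (hx : x ∈ X) (hx' : x' ∈ X)
    {t : ℝ} (ht : t ∈ Set.Ioo (0 : ℝ) 1) :
    t⁻¹ * (g (x + t • (x' - x)) - g x) ≤ g x' - g x - (1 - t) * (μ / 2 * ‖x' - x‖ ^ 2) := by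
  have h := hg.2 hx hx' (sub_nonneg.2 ht.2.le) ht.1.le (sub_add_cancel 1 t)
  have h1 : (1 - t) • x + t • x' = x + t • (x' - x) := by module
  rw [h1, norm_sub_rev, smul_eq_mul, smul_eq_mul] at h
  have ht0 := ht.1
  rw [inv_mul_le_iff₀ ht0]
  linarith

/-- The gradient inequality. Only the secants from `x` to `x'` in `X` are used, so that `X` may have
empty interior. -/
theorem gradient_inequality (hg : StrongConvexOn X μ g) (hx : x ∈ X) (hx' : x' ∈ X)
    (hd : DifferentiableAt ℝ g x) :
    inner ℝ (∇ g x) (x' - x) ≤ g x' - g x - μ / 2 * ‖x' - x‖ ^ 2 := by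
  have h1 : HasDerivAt (fun s : ℝ => g (x + s • (x' - x))) (inner ℝ (∇ g x) (x' - x)) 0 := by
    have hd' : DifferentiableAt ℝ g (x + ((0 : ℝ) * 1) • (x' - x)) := by simpa using hd
    simpa using hasDerivAt_line hd'
  rw [hasDerivAt_iff_tendsto_slope_zero] at h1
  have h2 := h1.mono_left (nhdsWithin_mono 0 (fun t (ht : t ∈ Set.Ioi 0) => ne_of_gt ht))
  have h3 : Filter.Tendsto
      (fun t : ℝ => g x' - g x - (1 - t) * (μ / 2 * ‖x' - x‖ ^ 2)) (nhdsWithin 0 (Set.Ioi 0))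
      (nhds (g x' - g x - (1 - 0) * (μ / 2 * ‖x' - x‖ ^ 2))) :=
    Continuous.continuousWithinAt (by fun_prop)
  rw [sub_zero, one_mul] at h3
  refine le_of_tendsto_of_tendsto h2 h3 ?_
  filter_upwards [Ioo_mem_nhdsGT (zero_lt_one' ℝ)] with t ht
  simpa using secant_le_of_strongConvexOn hg hx hx' ht

/-- Quadratic growth at a minimizer. -/
theorem le_sub_of_isMinOn (hg : StrongConvexOn X μ g) (hx : x ∈ X) (hx' : x' ∈ X)
    (hmin : ∀ w ∈ X, g x ≤ g w) : μ / 2 * ‖x' - x‖ ^ 2 ≤ g x' - g x := by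
  have h : 0 ≤ g x' - g x - μ / 2 * ‖x' - x‖ ^ 2 := by
    refine le_sub_of_forall_le_sub_mul fun t ht => ?_
    refine le_trans ?_ (secant_le_of_strongConvexOn hg hx hx' ht)
    refine mul_nonneg (inv_nonneg.2 ht.1.le) (sub_nonneg.2 (hmin _ ?_))
    have h1 : (1 - t) • x + t • x' = x + t • (x' - x) := by module
    rw [← h1]
    exact hg.1 hx hx' (by linarith [ht.2]) ht.1.le (by ring)
  linarith

end Operator

/-! ### The saddle-point operator and its stochastic estimator -/

section Problem
variable {n m : ℕ} {X : Set (E n)} {Y : Set (E m)} {f : E n → E m → ℝ}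
  {μ Lx Ly Lxy M D L : ℝ}

theorem subset_enlarge : X ⊆ enlarge X := Metric.self_subset_cthickening X

theorem add_mem_enlarge {x u : E n} (hx : x ∈ X) (hu : ‖u‖ ≤ 1) : x + u ∈ enlarge X :=
  Metric.mem_cthickening_of_dist_le _ x _ _ hx (by simpa using hu)

theorem IsProblem.isClosed_feasible (H : IsProblem X Y f μ Lx Ly Lxy M D) :
    IsClosed (feasible X Y) :=
  (H.closed_X.preimage (WithLp.continuous_fst 2 _ _)).inter
    (H.closed_Y.preimage (WithLp.continuous_snd 2 _ _))

theorem IsProblem.convex_feasible (H : IsProblem X Y f μ Lx Ly Lxy M D) :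
    Convex ℝ (feasible X Y) := fun _ hz _ hz' _ _ ha hb hab =>
  ⟨H.convex_X hz.1 hz'.1 ha hb hab, H.convex_Y hz.2 hz'.2 ha hb hab⟩

/-- The solution satisfies the variational inequality of `F` strongly: half of the modulus comes
from the gradient inequalities at `z`, and half from the quadratic growth at the saddle point. -/
theorem IsProblem.inner_gradOp_ge (H : IsProblem X Y f μ Lx Ly Lxy M D) {z zs : Pt n m}
    (hz : z ∈ feasible X Y) (hs : IsSolution X Y f zs) :
    μ * ‖z - zs‖ ^ 2 ≤ inner ℝ (gradOp f z) (z - zs) := by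
  obtain ⟨⟨hsx, hsy⟩, hsad⟩ := hs
  obtain ⟨hx, hy⟩ := hz
  have hcx := H.strongly_convex _ hy
  have hcy : StrongConvexOn Y μ (-fun y => f z.fst y) := (H.strongly_concave _ hx).neg
  have h1 := gradient_inequality hcx hx hsx
    (H.diff_x _ (subset_enlarge hx) _ (subset_enlarge hy))
  have hdy := H.diff_y _ (subset_enlarge hx) _ (subset_enlarge hy)
  have h2 := gradient_inequality hcy hy hsy hdy.neg
  have hgn : ∇ (-fun y => f z.fst y) z.snd = -∇ (fun y => f z.fst y) z.snd := by
    rw [gradient, fderiv_neg, map_neg]; rfl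
  have h3 := le_sub_of_isMinOn (H.strongly_convex _ hsy) hsx hx
    (fun w hw => hsad w hw _ hsy)
  have h4 := le_sub_of_isMinOn (g := -fun y => f zs.fst y) (H.strongly_concave _ hsx).neg hsy hy
    (fun w hw => neg_le_neg (hsad _ hsx w hw))
  rw [hgn] at h2
  simp only [Pi.neg_apply] at h2 h4
  rw [WithLp.prod_norm_sq_eq_of_L2, WithLp.prod_inner_apply]
  simp only [gradOp, WithLp.ofLp_fst, WithLp.ofLp_snd, WithLp.sub_fst, WithLp.sub_snd]
  rw [← neg_sub zs.fst z.fst, inner_neg_right, ← neg_sub zs.snd z.snd, inner_neg_right, norm_neg,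
    norm_neg]
  rw [norm_sub_rev] at h3 h4
  linarith

theorem IsProblem.norm_gradOp_sub_le (H : IsProblem X Y f μ Lx Ly Lxy M D)
    (hL : L = 2 * max Lx (max Ly Lxy)) (hL0 : 0 < L) {z z' : Pt n m}
    (hz : z ∈ feasible X Y) (hz' : z' ∈ feasible X Y) :
    ‖gradOp f z - gradOp f z'‖ ≤ L * ‖z - z'‖ := by
  have hx := subset_enlarge hz.1
  have hy := subset_enlarge hz.2
  have hx' := subset_enlarge hz'.1
  have hy' := subset_enlarge hz'.2
  have hLx : Lx ≤ L / 2 := by rw [hL]; simp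
  have hLy : Ly ≤ L / 2 := by rw [hL]; simp
  have hLxy : Lxy ≤ L / 2 := by rw [hL]; simp
  have e1 := H.lip_xx _ hx _ hx' _ hy
  have e2 := H.lip_xy _ hx' _ hy _ hy'
  have e3 := H.lip_yx _ hx _ hx' _ hy
  have e4 := H.lip_yy _ hx' _ hy _ hy'
  set a := ‖z.fst - z'.fst‖
  set b := ‖z.snd - z'.snd‖
  have ha : 0 ≤ a := norm_nonneg _
  have hb : 0 ≤ b := norm_nonneg _
  have k1 := mul_le_mul_of_nonneg_right hLx ha
  have k2 := mul_le_mul_of_nonneg_right hLxy hb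
  have k3 := mul_le_mul_of_nonneg_right hLxy ha
  have k4 := mul_le_mul_of_nonneg_right hLy hb
  have f1 : ‖(gradOp f z - gradOp f z').fst‖ ≤ L / 2 * (a + b) := by
    have := norm_sub_le_norm_sub_add_norm_sub (∇ (fun w => f w z.snd) z.fst)
      (∇ (fun w => f w z.snd) z'.fst) (∇ (fun w => f w z'.snd) z'.fst)
    rw [WithLp.sub_fst]
    simp only [gradOp, WithLp.toLp_fst]
    linarith
  have f2 : ‖(gradOp f z - gradOp f z').snd‖ ≤ L / 2 * (a + b) := by
    have := norm_sub_le_norm_sub_add_norm_sub (∇ (fun w => f z.fst w) z.snd)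
      (∇ (fun w => f z'.fst w) z.snd) (∇ (fun w => f z'.fst w) z'.snd)
    rw [WithLp.sub_snd]
    simp only [gradOp, WithLp.toLp_snd]
    rw [neg_sub_neg, norm_sub_rev]
    linarith
  refine (pow_le_pow_iff_left₀ (norm_nonneg _) (by positivity) two_ne_zero).1 ?_
  rw [mul_pow, WithLp.prod_norm_sq_eq_of_L2, WithLp.prod_norm_sq_eq_of_L2 (z - z'),
    WithLp.sub_fst z, WithLp.sub_snd z]
  have g1 := pow_le_pow_left₀ (norm_nonneg _) f1 2
  have g2 := pow_le_pow_left₀ (norm_nonneg _) f2 2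
  have g3 : 0 ≤ L ^ 2 / 2 * (a - b) ^ 2 := by positivity
  change _ ≤ L ^ 2 * (a ^ 2 + b ^ 2)
  linarith

theorem IsProblem.norm_gradOp_sq_le (H : IsProblem X Y f μ Lx Ly Lxy M D) {z : Pt n m}
    (hz : z ∈ feasible X Y) : ‖gradOp f z‖ ^ 2 ≤ 2 * M ^ 2 := by
  have h1 := pow_le_pow_left₀ (norm_nonneg _) (H.grad_x_le _ hz.1 _ hz.2) 2
  have h2 := pow_le_pow_left₀ (norm_nonneg _) (H.grad_y_le _ hz.1 _ hz.2) 2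
  rw [WithLp.prod_norm_sq_eq_of_L2]
  simp only [gradOp, WithLp.toLp_fst, WithLp.toLp_snd, norm_neg]
  linarith

variable {Ξ : Type*} [MeasurableSpace Ξ] {P : Measure Ξ} {fhat : E n → E m → Ξ → ℝ}
  {σ ρx ρy : ℝ}

theorem IsOracle.isSmoothOracle_x (O : IsOracle P X Y f fhat σ)
    (H : IsProblem X Y f μ Lx Ly Lxy M D) (hLx : Lx ≤ L) {y : E m} (hy : y ∈ Y) :
    IsSmoothOracle P (enlarge X) (fun x => f x y) (fun x ξ => fhat x y ξ) σ L where
  measurable := by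
    have : Measurable (fun p : E n × Ξ => ((p.1, y, p.2) : E n × E m × Ξ)) := by fun_prop
    exact O.measurable.comp this
  diff x hx ξ := O.diff_x x hx y (subset_enlarge hy) ξ
  diff_mean x hx := H.diff_x x hx y (subset_enlarge hy)
  lip x hx x' hx' := (H.lip_xx x hx x' hx' y (subset_enlarge hy)).trans (by gcongr)
  mean x hx := O.mean x hx y (subset_enlarge hy)
  var x hx := O.var_grad_x x hx y (subset_enlarge hy)

theorem IsOracle.isSmoothOracle_y (O : IsOracle P X Y f fhat σ)
    (H : IsProblem X Y f μ Lx Ly Lxy M D) (hLy : Ly ≤ L) {x : E n} (hx : x ∈ X) :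
    IsSmoothOracle P (enlarge Y) (fun y => f x y) (fun y ξ => fhat x y ξ) σ L where
  measurable := by
    have : Measurable (fun p : E m × Ξ => ((x, p.1, p.2) : E n × E m × Ξ)) := by fun_prop
    exact O.measurable.comp this
  diff y hy ξ := O.diff_y x (subset_enlarge hx) y hy ξ
  diff_mean y hy := H.diff_y x (subset_enlarge hx) y hy
  lip y hy y' hy' := (H.lip_yy x (subset_enlarge hx) y hy y' hy').trans (by gcongr)
  mean y hy := O.mean x (subset_enlarge hx) y hy
  var y hy := O.var_grad_y x (subset_enlarge hx) y hy

theorem IsOracle.measurable_zoGrad (O : IsOracle P X Y f fhat σ) :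
    Measurable (fun p : Pt n m × Sample Ξ n m => zoGrad fhat ρx ρy p.1 p.2) := by
  have hfst : Measurable (fun z : Pt n m => z.fst) := (WithLp.continuous_fst 2 _ _).measurable
  have hsnd : Measurable (fun z : Pt n m => z.snd) := (WithLp.continuous_snd 2 _ _).measurable
  have h0 : Measurable (fun p : Pt n m × Sample Ξ n m => fhat p.1.fst p.1.snd p.2.1) :=
    O.measurable.comp (f := fun p : Pt n m × Sample Ξ n m => (p.1.fst, p.1.snd, p.2.1))
      (by fun_prop)
  have h1 : Measurable (fun p : Pt n m × Sample Ξ n m =>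
      fhat (p.1.fst + ρx • p.2.2.1) p.1.snd p.2.1) :=
    O.measurable.comp
      (f := fun p : Pt n m × Sample Ξ n m => (p.1.fst + ρx • p.2.2.1, p.1.snd, p.2.1))
      (by fun_prop)
  have h2 : Measurable (fun p : Pt n m × Sample Ξ n m =>
      fhat p.1.fst (p.1.snd + ρy • p.2.2.2) p.2.1) :=
    O.measurable.comp
      (f := fun p : Pt n m × Sample Ξ n m => (p.1.fst, p.1.snd + ρy • p.2.2.2, p.2.1))
      (by fun_prop)
  exact (WithLp.measurable_toLp 2 _).comp
    ((((h1.sub h0).const_mul _).smul measurable_snd.snd.fst).prodMk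
      (((h2.sub h0).const_mul _).smul measurable_snd.snd.snd).neg)

/-- The law of one sample `(ξ, u, v)`. -/
def sampleLaw (n m : ℕ) (P : Measure Ξ) : Measure (Sample Ξ n m) :=
  P.prod ((uniformSphere n).prod (uniformSphere m))

variable [IsProbabilityMeasure P]

theorem isProbabilityMeasure_sampleLaw (hn : 1 ≤ n) (hm : 1 ≤ m) :
    IsProbabilityMeasure (sampleLaw n m P) := by
  have := isProbabilityMeasure_uniformSphere hn
  have := isProbabilityMeasure_uniformSphere hm
  unfold sampleLaw
  infer_instance

theorem measurePreserving_sample_x (hn : 1 ≤ n) (hm : 1 ≤ m) :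
    MeasurePreserving (fun s : Sample Ξ n m => (s.1, s.2.1)) (sampleLaw n m P)
      (P.prod (uniformSphere n)) := by
  have := isProbabilityMeasure_uniformSphere hn
  have := isProbabilityMeasure_uniformSphere hm
  exact (MeasurePreserving.id P).prod measurePreserving_fst

theorem measurePreserving_sample_y (hn : 1 ≤ n) (hm : 1 ≤ m) :
    MeasurePreserving (fun s : Sample Ξ n m => (s.1, s.2.2)) (sampleLaw n m P)
      (P.prod (uniformSphere m)) := by
  have := isProbabilityMeasure_uniformSphere hn
  have := isProbabilityMeasure_uniformSphere hm
  exact (MeasurePreserving.id P).prod measurePreserving_snd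

theorem IsOracle.zoGrad_sub_sq_le (O : IsOracle P X Y f fhat σ)
    (H : IsProblem X Y f μ Lx Ly Lxy M D) (hn : 1 ≤ n) (hm : 1 ≤ m) (hL : 0 ≤ L) (hLx : Lx ≤ L)
    (hLy : Ly ≤ L) (hρx : 0 < ρx) (hρx1 : ρx ≤ 1) (hρy : 0 < ρy) (hρy1 : ρy ≤ 1) {z : Pt n m}
    (hz : z ∈ feasible X Y) :
    Integrable (fun s => ‖zoGrad fhat ρx ρy z s - gradOp f z‖ ^ 2) (sampleLaw n m P) ∧
      ∫ s, ‖zoGrad fhat ρx ρy z s - gradOp f z‖ ^ 2 ∂(sampleLaw n m P) ≤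
        4 * (n ^ 2 + m ^ 2) * (σ ^ 2 + (M + L) ^ 2) + 4 * M ^ 2 := by
  have := isProbabilityMeasure_sampleLaw (P := P) hn hm
  have Ox := O.isSmoothOracle_x H hLx hz.2
  have Oy := O.isSmoothOracle_y H hLy hz.1
  have hx := Ox.sphereGrad_sq_le hn hL hρx hρx1 (H.grad_x_le _ hz.1 _ hz.2)
    (fun u hu => add_mem_enlarge hz.1 hu)
  have hy := Oy.sphereGrad_sq_le hm hL hρy hρy1 (H.grad_y_le _ hz.1 _ hz.2)
    (fun u hu => add_mem_enlarge hz.2 hu)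
  have px := measurePreserving_sample_x (P := P) hn hm
  have py := measurePreserving_sample_y (P := P) hn hm
  have hm0 : Measurable (zoGrad fhat ρx ρy z) :=
    Measurable.of_uncurry_left (f := zoGrad fhat ρx ρy) O.measurable_zoGrad
  obtain ⟨a, ha⟩ : ∃ a : Sample Ξ n m → ℝ, a = fun s =>
    ‖sphereGrad (fun x ξ => fhat x z.snd ξ) ρx z.fst (s.1, s.2.1)‖ ^ 2 := ⟨_, rfl⟩
  obtain ⟨b, hb⟩ : ∃ b : Sample Ξ n m → ℝ, b = fun s =>
    ‖sphereGrad (fun y ξ => fhat z.fst y ξ) ρy z.snd (s.1, s.2.2)‖ ^ 2 := ⟨_, rfl⟩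
  have ix : Integrable a (sampleLaw n m P) := ha ▸ px.integrable_comp_of_integrable hx.1
  have iy : Integrable b (sampleLaw n m P) := hb ▸ py.integrable_comp_of_integrable hy.1
  have ex := integral_map (μ := sampleLaw n m P) px.measurable.aemeasurable
    (f := fun p => ‖sphereGrad (fun x ξ => fhat x z.snd ξ) ρx z.fst p‖ ^ 2)
    (by rw [px.map_eq]; exact hx.1.aestronglyMeasurable)
  have ey := integral_map (μ := sampleLaw n m P) py.measurable.aemeasurable
    (f := fun p => ‖sphereGrad (fun y ξ => fhat z.fst y ξ) ρy z.snd p‖ ^ 2)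
    (by rw [py.map_eq]; exact hy.1.aestronglyMeasurable)
  rw [px.map_eq, ← ha] at ex
  rw [py.map_eq, ← hb] at ey
  have hab : Integrable (fun s => a s + b s) (sampleLaw n m P) := ix.add iy
  have hsum : Integrable (fun s => 2 * (a s + b s) + 4 * M ^ 2) (sampleLaw n m P) :=
    (hab.const_mul 2).add (integrable_const _)
  have hle : ∀ s, ‖zoGrad fhat ρx ρy z s - gradOp f z‖ ^ 2 ≤ 2 * (a s + b s) + 4 * M ^ 2 := by
    intro s
    have h1 := norm_sub_sq_le_two (zoGrad fhat ρx ρy z s) (gradOp f z)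
    have h2 := H.norm_gradOp_sq_le hz
    have h3 : ‖zoGrad fhat ρx ρy z s‖ ^ 2 = a s + b s := by
      rw [WithLp.prod_norm_sq_eq_of_L2, ha, hb]
      simp only [zoGrad, WithLp.toLp_fst, WithLp.toLp_snd, norm_neg, sphereGrad]
    linarith
  have hint : Integrable (fun s => ‖zoGrad fhat ρx ρy z s - gradOp f z‖ ^ 2)
      (sampleLaw n m P) := by
    refine hsum.mono' ((hm0.sub_const _).norm.pow_const 2).aestronglyMeasurable ?_
    exact Filter.Eventually.of_forall fun s => by
      rw [Real.norm_of_nonneg (by positivity)]; exact hle s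
  refine ⟨hint, (integral_mono hint hsum hle).trans ?_⟩
  rw [integral_add (hab.const_mul 2) (integrable_const _), integral_const_mul,
    integral_add ix iy, ← ex, ← ey]
  simp only [integral_const, probReal_univ, smul_eq_mul, one_mul]
  linarith [hx.2, hy.2]

theorem IsOracle.norm_integral_zoGrad_sub_le (O : IsOracle P X Y f fhat σ)
    (H : IsProblem X Y f μ Lx Ly Lxy M D) (hn : 1 ≤ n) (hm : 1 ≤ m) (hL : 0 ≤ L) (hLx : Lx ≤ L)
    (hLy : Ly ≤ L) (hρx : 0 < ρx) (hρx1 : ρx ≤ 1) (hρy : 0 < ρy) (hρy1 : ρy ≤ 1) {z : Pt n m}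
    (hz : z ∈ feasible X Y) :
    ‖∫ s, (zoGrad fhat ρx ρy z s - gradOp f z) ∂(sampleLaw n m P)‖ ≤
      n * L * ρx + m * L * ρy := by
  have := isProbabilityMeasure_sampleLaw (P := P) hn hm
  have Ox := O.isSmoothOracle_x H hLx hz.2
  have Oy := O.isSmoothOracle_y H hLy hz.1
  have gx := H.grad_x_le _ hz.1 _ hz.2
  have gy := H.grad_y_le _ hz.1 _ hz.2
  have ux : ∀ u : E n, ‖u‖ ≤ 1 → z.fst + u ∈ enlarge X := fun u hu => add_mem_enlarge hz.1 hu
  have uy : ∀ u : E m, ‖u‖ ≤ 1 → z.snd + u ∈ enlarge Y := fun u hu => add_mem_enlarge hz.2 hu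
  have hx := Ox.norm_integral_sphereGrad_sub_le hn hL hρx hρx1 gx ux
  have hy := Oy.norm_integral_sphereGrad_sub_le hm hL hρy hρy1 gy uy
  have kx := Ox.integrable_sphereGrad hn hL hρx hρx1 gx ux
  have ky := Oy.integrable_sphereGrad hm hL hρy hρy1 gy uy
  have px := measurePreserving_sample_x (P := P) hn hm
  have py := measurePreserving_sample_y (P := P) hn hm
  have ix := px.integrable_comp_of_integrable kx
  have iy := py.integrable_comp_of_integrable ky
  have ex := integral_map (μ := sampleLaw n m P) px.measurable.aemeasurable
    (f := sphereGrad (fun x ξ => fhat x z.snd ξ) ρx z.fst)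
    (by rw [px.map_eq]; exact kx.aestronglyMeasurable)
  have ey := integral_map (μ := sampleLaw n m P) py.measurable.aemeasurable
    (f := sphereGrad (fun y ξ => fhat z.fst y ξ) ρy z.snd)
    (by rw [py.map_eq]; exact ky.aestronglyMeasurable)
  rw [px.map_eq] at ex
  rw [py.map_eq] at ey
  have hint : Integrable (fun s => zoGrad fhat ρx ρy z s) (sampleLaw n m P) :=
    Integrable.of_fst_of_snd_prodLp ⟨ix, iy.neg⟩
  rw [integral_sub hint (integrable_const _)]
  simp only [integral_const, probReal_univ, one_smul]
  set I := ∫ s, zoGrad fhat ρx ρy z s ∂(sampleLaw n m P) with hI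
  have h1 : I.fst = ∫ p, sphereGrad (fun x ξ => fhat x z.snd ξ) ρx z.fst p
      ∂(P.prod (uniformSphere n)) := by
    rw [hI, fst_integral_withLp hint, ex]; rfl
  have h2 : I.snd = -∫ p, sphereGrad (fun y ξ => fhat z.fst y ξ) ρy z.snd p
      ∂(P.prod (uniformSphere m)) := by
    rw [hI, snd_integral_withLp hint, ey, ← integral_neg]; rfl
  have e1 : ‖(I - gradOp f z).fst‖ ≤ n * L * ρx := by
    rw [WithLp.sub_fst, h1]; exact hx
  have e2 : ‖(I - gradOp f z).snd‖ ≤ m * L * ρy := by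
    rw [WithLp.sub_snd, h2]
    simp only [gradOp, WithLp.toLp_snd]
    rw [neg_sub_neg, norm_sub_rev]; exact hy
  refine (pow_le_pow_iff_left₀ (norm_nonneg _) (by positivity) two_ne_zero).1 ?_
  rw [WithLp.prod_norm_sq_eq_of_L2]
  have q1 := pow_le_pow_left₀ (norm_nonneg _) e1 2
  have q2 := pow_le_pow_left₀ (norm_nonneg _) e2 2
  have q3 : 0 ≤ (n * L * ρx) * (m * L * ρy) := by positivity
  linarith

end Problem

/-! ### Averages over batches of independent samples -/

theorem integrable_inner_of_memLp_two {Ω V : Type*} [MeasurableSpace Ω] {Pr : Measure Ω}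
    [NormedAddCommGroup V] [InnerProductSpace ℝ V] {f g : Ω → V} (hf : MemLp f 2 Pr)
    (hg : MemLp g 2 Pr) : Integrable (fun ω => inner ℝ (f ω) (g ω)) Pr := by
  refine (hf.norm.integrable_mul hg.norm).mono'
    (hf.aestronglyMeasurable.inner hg.aestronglyMeasurable) ?_
  exact Filter.Eventually.of_forall fun ω => norm_inner_le_norm _ _

section Independence
variable {Ω A B V : Type*} [MeasurableSpace Ω] [MeasurableSpace A] [MeasurableSpace B]
  {Pr : Measure Ω} [IsProbabilityMeasure Pr] {ν : Measure B} {W : Ω → A} {s : Ω → B}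

theorem map_prodMk_eq_prod (hW : Measurable W) (hs : Measurable s) (hlaw : Pr.map s = ν)
    (hind : IndepFun W s Pr) : Pr.map (fun ω => (W ω, s ω)) = (Pr.map W).prod ν := by
  rw [(indepFun_iff_map_prod_eq_prod_map_map hW.aemeasurable hs.aemeasurable).1 hind, hlaw]

variable [IsProbabilityMeasure ν] [NormedAddCommGroup V] [MeasurableSpace V] [BorelSpace V]
  [SecondCountableTopology V] {G : A → B → V} {v b : ℝ}

/-- If `s` is independent of `W`, then a uniform bound on the second moments of `G a s` passes to
`G W s`. -/
theorem memLp_two_of_indepFun (hG : Measurable (Function.uncurry G)) (hW : Measurable W)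
    (hs : Measurable s) (hlaw : Pr.map s = ν) (hind : IndepFun W s Pr) (hv : 0 ≤ v)
    (hsq : ∀ a, Integrable (fun y => ‖G a y‖ ^ 2) ν ∧ ∫ y, ‖G a y‖ ^ 2 ∂ν ≤ v) :
    MemLp (fun ω => G (W ω) (s ω)) 2 Pr ∧ ∫ ω, ‖G (W ω) (s ω)‖ ^ 2 ∂Pr ≤ v := by
  have hGW : Measurable (fun ω => G (W ω) (s ω)) := hG.comp (hW.prodMk hs)
  have : IsProbabilityMeasure (Pr.map W) := Measure.isProbabilityMeasure_map hW.aemeasurable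
  have hlin : ∫⁻ ω, ENNReal.ofReal (‖G (W ω) (s ω)‖ ^ 2) ∂Pr ≤ ENNReal.ofReal v := by
    have hm : Measurable fun p : A × B => ENNReal.ofReal (‖Function.uncurry G p‖ ^ 2) :=
      (hG.norm.pow_const 2).ennreal_ofReal
    calc ∫⁻ ω, ENNReal.ofReal (‖G (W ω) (s ω)‖ ^ 2) ∂Pr
        = ∫⁻ p, ENNReal.ofReal (‖Function.uncurry G p‖ ^ 2)
            ∂(Pr.map fun ω => (W ω, s ω)) := by
          rw [lintegral_map hm (hW.prodMk hs)]; rfl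
      _ = ∫⁻ a, ∫⁻ y, ENNReal.ofReal (‖G a y‖ ^ 2) ∂ν ∂(Pr.map W) := by
          rw [map_prodMk_eq_prod hW hs hlaw hind, lintegral_prod _ hm.aemeasurable]; rfl
      _ ≤ ∫⁻ a, ENNReal.ofReal v ∂(Pr.map W) := by
          refine lintegral_mono fun a => ?_
          rw [← ofReal_integral_eq_lintegral_ofReal (hsq a).1
            (Filter.Eventually.of_forall fun y => by positivity)]
          exact ENNReal.ofReal_le_ofReal (hsq a).2
      _ = _ := by simp
  have hnn : 0 ≤ᵐ[Pr] fun ω => ‖G (W ω) (s ω)‖ ^ 2 :=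
    Filter.Eventually.of_forall fun p => by positivity
  have hm := (hGW.norm.pow_const 2).aestronglyMeasurable (μ := Pr)
  refine ⟨(memLp_two_iff_integrable_sq_norm hGW.aestronglyMeasurable).2 ⟨hm, ?_⟩, ?_⟩
  · rw [hasFiniteIntegral_iff_ofReal hnn]
    exact hlin.trans_lt ENNReal.ofReal_lt_top
  · rw [integral_eq_lintegral_of_nonneg_ae hnn hm]
    exact ENNReal.toReal_le_of_le_ofReal hv hlin


variable [InnerProductSpace ℝ V] [CompleteSpace V]

/-- If `s` is independent of `W`, then in an inner product with a function of `W` the variable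
`G W s` may be replaced by its mean over `s`. -/
theorem integral_inner_of_indepFun (hG : Measurable (Function.uncurry G)) (hW : Measurable W)
    (hs : Measurable s) (hlaw : Pr.map s = ν) (hind : IndepFun W s Pr)
    (hint : ∀ a, Integrable (G a) ν) (hGW : MemLp (fun ω => G (W ω) (s ω)) 2 Pr) {U : A → V}
    (hU : Measurable U) (hUW : MemLp (fun ω => U (W ω)) 2 Pr) :
    ∫ ω, inner ℝ (G (W ω) (s ω)) (U (W ω)) ∂Pr =
      ∫ ω, inner ℝ (∫ y, G (W ω) y ∂ν) (U (W ω)) ∂Pr := by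
  have : IsProbabilityMeasure (Pr.map W) := Measure.isProbabilityMeasure_map hW.aemeasurable
  have hi : Integrable (fun ω => inner ℝ (G (W ω) (s ω)) (U (W ω))) Pr :=
    integrable_inner_of_memLp_two hGW hUW
  set Φ : A × B → ℝ := fun p => inner ℝ (Function.uncurry G p) (U p.1)
  have hΦ : Measurable Φ := hG.inner (hU.comp measurable_fst)
  have hWs := (hW.prodMk hs).aemeasurable (μ := Pr)
  have hΦi : Integrable Φ ((Pr.map W).prod ν) := by
    rw [← map_prodMk_eq_prod hW hs hlaw hind, integrable_map_measure hΦ.aestronglyMeasurable hWs]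
    exact hi
  have hβ : Measurable (fun a => ∫ y, G a y ∂ν) :=
    (hG.stronglyMeasurable.integral_prod_right (ν := ν)).measurable
  calc ∫ ω, inner ℝ (G (W ω) (s ω)) (U (W ω)) ∂Pr
      = ∫ p, Φ p ∂(Pr.map fun ω => (W ω, s ω)) := by
        rw [integral_map hWs hΦ.aestronglyMeasurable]; rfl
    _ = ∫ a, ∫ y, Φ (a, y) ∂ν ∂(Pr.map W) := by
        rw [map_prodMk_eq_prod hW hs hlaw hind, integral_prod _ hΦi]
    _ = ∫ a, inner ℝ (∫ y, G a y ∂ν) (U a) ∂(Pr.map W) := by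
        congr 1
        funext a
        rw [real_inner_comm, ← integral_inner (hint a)]
        exact integral_congr_ae (Filter.Eventually.of_forall fun y => real_inner_comm _ _)
    _ = _ := by
        rw [integral_map hW.aemeasurable (hβ.inner hU).aestronglyMeasurable]

/-- The average of `G a` over the first `t` entries of `y`. -/
def batchAvg (G : A → B → V) (t : ℕ) (y : ℕ → B) (a : A) : V :=
  (t : ℝ)⁻¹ • ∑ i ∈ range t, G a (y i)

variable {S : ℕ → Ω → B} {t : ℕ}

/-- The second moment of the average of a batch of fresh samples: the variance part decays like
`1 / t`, while the squared bias stays. -/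
theorem batchAvg_sq_le (hG : Measurable (Function.uncurry G)) (hW : Measurable W)
    (hS : ∀ i, Measurable (S i)) (hlaw : ∀ i, Pr.map (S i) = ν)
    (hind : ∀ i, IndepFun W (S i) Pr)
    (hind' : ∀ i j, i ≠ j → IndepFun (fun ω => (W ω, S i ω)) (S j) Pr) (hv : 0 ≤ v)
    (hsq : ∀ a, Integrable (fun y => ‖G a y‖ ^ 2) ν ∧ ∫ y, ‖G a y‖ ^ 2 ∂ν ≤ v)
    (hbias : ∀ a, ‖∫ y, G a y ∂ν‖ ≤ b) (ht : 0 < t) :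
    MemLp (fun ω => batchAvg G t (fun i => S i ω) (W ω)) 2 Pr ∧
      ∫ ω, ‖batchAvg G t (fun i => S i ω) (W ω)‖ ^ 2 ∂Pr ≤ v / t + b ^ 2 := by
  have hmem := fun i => memLp_two_of_indepFun hG hW (hS i) (hlaw i) (hind i) hv hsq
  have hint : ∀ a, Integrable (G a) ν := fun a =>
    ((memLp_two_iff_integrable_sq_norm
      (hG.of_uncurry_left (x := a)).aestronglyMeasurable).2 (hsq a).1).integrable one_le_two
  have hβ : Measurable (fun a => ∫ y, G a y ∂ν) :=
    (hG.stronglyMeasurable.integral_prod_right (ν := ν)).measurable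
  have hβW : MemLp (fun ω => ∫ y, G (W ω) y ∂ν) 2 Pr :=
    MemLp.of_bound (hβ.comp hW).aestronglyMeasurable b
      (Filter.Eventually.of_forall fun ω => hbias _)
  -- distinct samples are independent given `W`, so that only the means over both remain
  have hcross : ∀ i j, i ≠ j →
      ∫ ω, inner ℝ (G (W ω) (S i ω)) (G (W ω) (S j ω)) ∂Pr ≤ b ^ 2 := by
    intro i j hij
    have h1 := integral_inner_of_indepFun (G := fun (p : A × B) y => G p.1 y)
      (W := fun ω => (W ω, S i ω)) (s := S j) (ν := ν) (Pr := Pr)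
      (hG.comp ((measurable_fst.comp measurable_fst).prodMk measurable_snd))
      (hW.prodMk (hS i)) (hS j) (hlaw j) (hind' i j hij) (fun p => hint p.1) (hmem j).1
      (U := Function.uncurry G) hG (hmem i).1
    have h2 := integral_inner_of_indepFun hG hW (hS i) (hlaw i) (hind i) hint (hmem i).1 hβ hβW
    simp only [Function.uncurry] at h1
    simp_rw [real_inner_comm (G (W _) (S j _)), h1]
    simp_rw [real_inner_comm (G (W _) (S i _)), h2]
    calc _ ≤ ∫ _, b ^ 2 ∂Pr := by
          refine integral_mono (integrable_inner_of_memLp_two hβW hβW) (integrable_const _)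
            fun ω => ?_
          change inner ℝ (∫ y, G (W ω) y ∂ν) (∫ y, G (W ω) y ∂ν) ≤ b ^ 2
          rw [real_inner_self_eq_norm_sq]
          exact pow_le_pow_left₀ (norm_nonneg _) (hbias _) 2
      _ = b ^ 2 := by simp
  -- the diagonal contributes the second moments, and all pairs together the squared bias
  have hpair : ∀ i j, ∫ ω, inner ℝ (G (W ω) (S i ω)) (G (W ω) (S j ω)) ∂Pr ≤
      (if i = j then v else 0) + b ^ 2 := by
    intro i j
    split_ifs with hij
    · subst hij
      simp_rw [real_inner_self_eq_norm_sq]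
      linarith [(hmem i).2, sq_nonneg b]
    · rw [zero_add]; exact hcross i j hij
  have hexp : ∀ ω, ‖batchAvg G t (fun i => S i ω) (W ω)‖ ^ 2 =
      (t : ℝ)⁻¹ ^ 2 * ∑ i ∈ range t, ∑ j ∈ range t,
        inner ℝ (G (W ω) (S i ω)) (G (W ω) (S j ω)) := by
    intro ω
    rw [batchAvg, norm_smul, mul_pow, Real.norm_of_nonneg (by positivity),
      ← real_inner_self_eq_norm_sq, sum_inner]
    simp_rw [inner_sum]
  refine ⟨(memLp_finsetSum (range t) (f := fun i ω => G (W ω) (S i ω))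
    fun i _ => (hmem i).1).const_smul _, ?_⟩
  have hii : ∀ i j, Integrable (fun ω => inner ℝ (G (W ω) (S i ω)) (G (W ω) (S j ω))) Pr :=
    fun i j => integrable_inner_of_memLp_two (hmem i).1 (hmem j).1
  simp_rw [hexp]
  rw [integral_const_mul, integral_finsetSum _ fun i _ => integrable_finsetSum _ fun j _ => hii i j]
  simp_rw [fun i => integral_finsetSum (range t) fun j (_ : j ∈ range t) => hii i j]
  calc _ ≤ (t : ℝ)⁻¹ ^ 2 * ∑ i ∈ range t, ∑ j ∈ range t, ((if i = j then v else 0) + b ^ 2) := by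
        gcongr with i _ j _
        exact hpair i j
    _ = (t : ℝ)⁻¹ ^ 2 * (t * v + t * (t * b ^ 2)) := by
        congr 1
        have h1 : ∀ i ∈ range t, ∑ j ∈ range t, ((if i = j then v else 0) + b ^ 2) =
            v + t * b ^ 2 := by
          intro i hi
          rw [sum_add_distrib, Finset.sum_ite_eq, if_pos hi]
          simp
        rw [sum_congr rfl h1, sum_const, card_range, nsmul_eq_mul]
        ring
    _ = _ := by
        have : (t : ℝ) ≠ 0 := by positivity
        field_simp

/-- Against a bounded function of `W`, a batch of fresh samples contributes only its bias. -/
theorem neg_le_integral_inner_batchAvg (hG : Measurable (Function.uncurry G)) (hW : Measurable W)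
    (hS : ∀ i, Measurable (S i)) (hlaw : ∀ i, Pr.map (S i) = ν)
    (hind : ∀ i, IndepFun W (S i) Pr) (hv : 0 ≤ v) (hb : 0 ≤ b)
    (hsq : ∀ a, Integrable (fun y => ‖G a y‖ ^ 2) ν ∧ ∫ y, ‖G a y‖ ^ 2 ∂ν ≤ v)
    (hbias : ∀ a, ‖∫ y, G a y ∂ν‖ ≤ b) (ht : 0 < t) {U : A → V} (hU : Measurable U) {d : ℝ}
    (hd : ∀ ω, ‖U (W ω)‖ ≤ d) :
    -(b * d) ≤ ∫ ω, inner ℝ (batchAvg G t (fun i => S i ω) (W ω)) (U (W ω)) ∂Pr := by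
  have hmem := fun i => memLp_two_of_indepFun hG hW (hS i) (hlaw i) (hind i) hv hsq
  have hint : ∀ a, Integrable (G a) ν := fun a =>
    ((memLp_two_iff_integrable_sq_norm
      (hG.of_uncurry_left (x := a)).aestronglyMeasurable).2 (hsq a).1).integrable one_le_two
  have hβ : Measurable (fun a => ∫ y, G a y ∂ν) :=
    (hG.stronglyMeasurable.integral_prod_right (ν := ν)).measurable
  have hβW : MemLp (fun ω => ∫ y, G (W ω) y ∂ν) 2 Pr :=
    MemLp.of_bound (hβ.comp hW).aestronglyMeasurable b
      (Filter.Eventually.of_forall fun ω => hbias _)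
  have hUW : MemLp (fun ω => U (W ω)) 2 Pr :=
    MemLp.of_bound (hU.comp hW).aestronglyMeasurable d (Filter.Eventually.of_forall hd)
  have hone : ∀ i, -(b * d) ≤ ∫ ω, inner ℝ (G (W ω) (S i ω)) (U (W ω)) ∂Pr := by
    intro i
    rw [integral_inner_of_indepFun hG hW (hS i) (hlaw i) (hind i) hint (hmem i).1 hU hUW]
    calc -(b * d) = ∫ _, -(b * d) ∂Pr := by simp
      _ ≤ _ := by
        refine integral_mono (integrable_const _) (integrable_inner_of_memLp_two hβW hUW)
          fun ω => ?_
        have h1 := abs_real_inner_le_norm (∫ y, G (W ω) y ∂ν) (U (W ω))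
        have h2 := mul_le_mul (hbias (W ω)) (hd ω) (norm_nonneg _) hb
        exact (neg_le_neg (h1.trans h2)).trans (neg_abs_le _)
  simp_rw [batchAvg, real_inner_smul_left, sum_inner]
  rw [integral_const_mul,
    integral_finsetSum _ fun i _ => integrable_inner_of_memLp_two (hmem i).1 hUW]
  calc -(b * d) = (t : ℝ)⁻¹ * ∑ i ∈ range t, -(b * d) := by
        have : (t : ℝ) ≠ 0 := by positivity
        rw [sum_const, card_range, nsmul_eq_mul]
        field_simp
    _ ≤ _ := by
        gcongr with i _
        exact hone i

end Independence

/-! ### Independence of a batch from the past -/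

section History
variable {n m : ℕ} {Ξ Ω : Type*} [MeasurableSpace Ξ] {S : ℕ → ℕ → Ω → Sample Ξ n m}

/-- The σ-algebra generated by the samples with index in `J`. -/
@[reducible] def history (S : ℕ → ℕ → Ω → Sample Ξ n m) (J : Set (ℕ × ℕ)) : MeasurableSpace Ω :=
  ⨆ q ∈ J, MeasurableSpace.comap (S q.1 q.2) inferInstance

theorem measurable_history {J : Set (ℕ × ℕ)} {h i : ℕ} (hJ : (h, i) ∈ J) :
    Measurable[history S J] (S h i) := by
  rw [measurable_iff_comap_le]
  exact le_iSup₂_of_le (h, i) hJ le_rfl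

theorem history_mono {J J' : Set (ℕ × ℕ)} (h : J ⊆ J') : history S J ≤ history S J' :=
  biSup_mono h

variable [mΩ : MeasurableSpace Ω] {P : Measure Ξ} {Pr : Measure Ω}

theorem IsSampling.history_le (hS : IsSampling P Pr S) (J : Set (ℕ × ℕ)) : history S J ≤ mΩ :=
  iSup₂_le fun q _ => measurable_iff_comap_le.1 (hS.measurable q.1 q.2)

theorem IsSampling.indepFun_of_notMem (hS : IsSampling P Pr S) {A : Type*} [MeasurableSpace A]
    {W : Ω → A} {J : Set (ℕ × ℕ)} {h i : ℕ} (hJ : (h, i) ∉ J) (hW : Measurable[history S J] W) :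
    IndepFun W (S h i) Pr := by
  rw [IndepFun_iff_Indep]
  have h1 := indep_iSup_of_disjoint (fun q => measurable_iff_comap_le.1 (hS.measurable q.1 q.2))
    ((iIndepFun_iff_iIndep _ _ _).1 hS.indep) (Set.disjoint_singleton_right.2 hJ)
  refine indep_of_indep_of_le_right (indep_of_indep_of_le_left h1 ?_) ?_
  · exact measurable_iff_comap_le.1 hW
  · exact le_iSup₂_of_le (h, i) rfl le_rfl

/-- The indices of the samples in the batches before `h`. -/
def pastIndices (h : ℕ) : Set (ℕ × ℕ) := {q | q.1 < h}

theorem IsSampling.indepFun_batch (hS : IsSampling P Pr S) {A : Type*} [MeasurableSpace A]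
    {W : Ω → A} {h : ℕ} (hW : Measurable[history S (pastIndices h)] W) (i : ℕ) :
    IndepFun W (S h i) Pr :=
  hS.indepFun_of_notMem (J := pastIndices h) (by simp [pastIndices]) hW

theorem IsSampling.indepFun_batch_pair (hS : IsSampling P Pr S) {A : Type*} [MeasurableSpace A]
    {W : Ω → A} {h : ℕ} (hW : Measurable[history S (pastIndices h)] W) {i j : ℕ} (hij : i ≠ j) :
    IndepFun (fun ω => (W ω, S h i ω)) (S h j) Pr := by
  refine hS.indepFun_of_notMem (J := insert (h, i) (pastIndices h)) ?_ ?_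
  · simp [pastIndices, hij.symm]
  · exact Measurable.prodMk (hW.mono (history_mono (Set.subset_insert _ _)) le_rfl)
      (measurable_history (Set.mem_insert _ _))

end History

/-! ### Measurability of the iterates -/

section Iterates
variable {n m : ℕ} {Ξ : Type*} (Z : Set (Pt n m)) (fhat : E n → E m → Ξ → ℝ)
  (p : Params) (z0 : Pt n m)

/-- The batch gradient at `z^k`. -/
def curGrad (S : ℕ → ℕ → Sample Ξ n m) (k : ℕ) : Pt n m :=
  batchGrad fhat p.ρx p.ρy (p.t k) (S (2 * k)) (run Z fhat p z0 S k).1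

/-- The intermediate point `z^{k+0.5}`. -/
def halfPt (S : ℕ → ℕ → Sample Ξ n m) (k : ℕ) : Pt n m :=
  proj Z ((run Z fhat p z0 S k).1 + p.β • ((run Z fhat p z0 S k).1 - (run Z fhat p z0 S k).2.1)
    - p.η • curGrad Z fhat p z0 S k)

/-- The batch gradient at `z^{k+0.5}`. -/
def halfGrad (S : ℕ → ℕ → Sample Ξ n m) (k : ℕ) : Pt n m :=
  batchGrad fhat p.ρx p.ρy (p.tHalf k) (S (2 * k + 1)) (halfPt Z fhat p z0 S k)

variable {Z fhat p z0} [MeasurableSpace Ξ] {Ω : Type*} [MeasurableSpace Ω]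
  {S : ℕ → ℕ → Ω → Sample Ξ n m} {k : ℕ}

theorem measurable_batchGrad {ρx ρy : ℝ} {t : ℕ} {s : ℕ → Ω → Sample Ξ n m} {z : Ω → Pt n m}
    (hg : Measurable fun q : Pt n m × Sample Ξ n m => zoGrad fhat ρx ρy q.1 q.2)
    (hs : ∀ i, Measurable (s i)) (hz : Measurable z) :
    Measurable fun ω => batchGrad fhat ρx ρy t (fun i => s i ω) (z ω) := by
  have h0 : ∀ i, Measurable fun ω => zoGrad fhat ρx ρy (z ω) (s i ω) := fun i =>
    Measurable.comp (g := fun q : Pt n m × Sample Ξ n m => zoGrad fhat ρx ρy q.1 q.2)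
      (f := fun ω => (z ω, s i ω)) hg (hz.prodMk (hs i))
  have h : Measurable fun ω => ∑ i ∈ range t, zoGrad fhat ρx ρy (z ω) (s i ω) :=
    Finset.measurable_fun_sum _ fun i _ => h0 i
  exact h.const_smul (t : ℝ)⁻¹

/-- The iterates `z^k` and `z^{k-1}` depend only on the batches before `2 * k`; the gradient at
`z^{k-1}` does too unless `k = 0`, when it is the one of batch `0`. -/
theorem measurable_run
    (hg : Measurable fun q : Pt n m × Sample Ξ n m => zoGrad fhat p.ρx p.ρy q.1 q.2)
    (hP : Measurable (proj Z)) (k : ℕ) :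
    ((∀ h < 2 * k, ∀ i, Measurable (S h i)) →
      Measurable (fun ω => (run Z fhat p z0 (fun h i => S h i ω) k).1) ∧
      Measurable (fun ω => (run Z fhat p z0 (fun h i => S h i ω) k).2.1)) ∧
    ((∀ h < 2 * k + 1, ∀ i, Measurable (S h i)) →
      Measurable (fun ω => (run Z fhat p z0 (fun h i => S h i ω) k).2.2) ∧
      Measurable (fun ω => curGrad Z fhat p z0 (fun h i => S h i ω) k) ∧
      Measurable (fun ω => halfPt Z fhat p z0 (fun h i => S h i ω) k)) := by
  induction k with
  | zero =>
    refine ⟨fun _ => ⟨measurable_const, measurable_const⟩, fun hS => ?_⟩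
    have h1 : Measurable fun ω => curGrad Z fhat p z0 (fun h i => S h i ω) 0 :=
      measurable_batchGrad (s := S (2 * 0)) (z := fun _ => z0) hg (hS (2 * 0) (by omega))
        measurable_const
    have h2 : Measurable fun ω => z0 + p.β • (z0 - z0)
        - p.η • curGrad Z fhat p z0 (fun h i => S h i ω) 0 :=
      measurable_const.sub (h1.const_smul p.η)
    exact ⟨h1, h1, hP.comp h2⟩
  | succ k ih =>
    have key : (∀ h < 2 * (k + 1), ∀ i, Measurable (S h i)) →
        Measurable (fun ω => (run Z fhat p z0 (fun h i => S h i ω) (k + 1)).1) ∧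
        Measurable (fun ω => (run Z fhat p z0 (fun h i => S h i ω) (k + 1)).2.1) := by
      intro hS
      obtain ⟨h1, h2⟩ := ih.1 fun h hh => hS h (by omega)
      obtain ⟨h3, h4, h5⟩ := ih.2 fun h hh => hS h (by omega)
      have h6 : Measurable fun ω => halfGrad Z fhat p z0 (fun h i => S h i ω) k :=
        measurable_batchGrad (s := S (2 * k + 1)) hg (hS (2 * k + 1) (by omega)) h5
      exact ⟨hP.comp (((h1.sub (h6.const_smul p.α)).add ((h1.sub h2).const_smul p.γ)).sub
        ((h4.sub h3).const_smul p.τ)), h1⟩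
    refine ⟨key, fun hS => ?_⟩
    obtain ⟨h1, h2⟩ := key fun h hh => hS h (by omega)
    have h3 : Measurable (fun ω => (run Z fhat p z0 (fun h i => S h i ω) (k + 1)).2.2) :=
      (ih.2 fun h hh => hS h (by omega)).2.1
    have h4 : Measurable fun ω => curGrad Z fhat p z0 (fun h i => S h i ω) (k + 1) :=
      measurable_batchGrad (s := S (2 * (k + 1))) hg (hS (2 * (k + 1)) (by omega)) h1
    exact ⟨h3, h4, hP.comp ((h1.add ((h1.sub h2).const_smul p.β)).sub (h4.const_smul p.η))⟩

end Iterates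

/-! ### The recursion for the expected energy -/

section Recursion
variable {n m : ℕ} {Ξ : Type*} [MeasurableSpace Ξ] {P : Measure Ξ}
  {Z : Set (Pt n m)} {F : Pt n m → Pt n m} {fhat : E n → E m → Ξ → ℝ}
  {ρx ρy L v b D : ℝ}

/-- On the bounded closed convex set `Z`, the zeroth-order gradient is an estimator of the
`L`-Lipschitz operator `F` with second moment of the error at most `v` and bias at most `b`. -/
structure IsNoisyOracle (P : Measure Ξ) (Z : Set (Pt n m)) (F : Pt n m → Pt n m)
    (fhat : E n → E m → Ξ → ℝ) (ρx ρy L v b D : ℝ) : Prop where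
  nonempty : Z.Nonempty
  closed : IsClosed Z
  convex : Convex ℝ Z
  bounded : ∀ z ∈ Z, ∀ z' ∈ Z, ‖z - z'‖ ≤ D
  prob : IsProbabilityMeasure (sampleLaw n m P)
  L_pos : 0 < L
  lip : ∀ z ∈ Z, ∀ z' ∈ Z, ‖F z - F z'‖ ≤ L * ‖z - z'‖
  measurable : Measurable fun q : Pt n m × Sample Ξ n m => zoGrad fhat ρx ρy q.1 q.2
  v_nonneg : 0 ≤ v
  b_nonneg : 0 ≤ b
  sq_le : ∀ z ∈ Z, Integrable (fun s => ‖zoGrad fhat ρx ρy z s - F z‖ ^ 2) (sampleLaw n m P) ∧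
    ∫ s, ‖zoGrad fhat ρx ρy z s - F z‖ ^ 2 ∂(sampleLaw n m P) ≤ v
  bias_le : ∀ z ∈ Z, ‖∫ s, (zoGrad fhat ρx ρy z s - F z) ∂(sampleLaw n m P)‖ ≤ b

theorem IsNoisyOracle.proj_mem (N : IsNoisyOracle P Z F fhat ρx ρy L v b D) (z : Pt n m) :
    proj Z z ∈ Z := SZO.proj_mem N.nonempty N.closed N.convex z

theorem IsNoisyOracle.measurable_proj (N : IsNoisyOracle P Z F fhat ρx ρy L v b D) :
    Measurable (proj Z) :=
  (lipschitzWith_proj N.nonempty N.closed N.convex).continuous.measurable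

theorem IsNoisyOracle.measurable_comp_proj (N : IsNoisyOracle P Z F fhat ρx ρy L v b D) :
    Measurable fun z => F (proj Z z) := by
  have h : LipschitzWith ⟨L, N.L_pos.le⟩ fun z => F (proj Z z) := by
    refine LipschitzWith.of_dist_le_mul fun z z' => ?_
    rw [dist_eq_norm]
    refine (N.lip _ (N.proj_mem z) _ (N.proj_mem z')).trans ?_
    have h1 := (lipschitzWith_proj N.nonempty N.closed N.convex).dist_le_mul z z'
    rw [NNReal.coe_one, one_mul, dist_eq_norm] at h1
    exact mul_le_mul_of_nonneg_left h1 N.L_pos.le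
  exact h.continuous.measurable

/-- The error of the zeroth-order gradient, extended from `Z` to the whole space by means of the
projection, which makes it jointly measurable. -/
def noise (Z : Set (Pt n m)) (F : Pt n m → Pt n m) (fhat : E n → E m → Ξ → ℝ) (ρx ρy : ℝ)
    (z : Pt n m) (s : Sample Ξ n m) : Pt n m :=
  zoGrad fhat ρx ρy (proj Z z) s - F (proj Z z)

theorem IsNoisyOracle.measurable_noise (N : IsNoisyOracle P Z F fhat ρx ρy L v b D) :
    Measurable (Function.uncurry (noise Z F fhat ρx ρy)) :=
  (N.measurable.comp ((N.measurable_proj.comp measurable_fst).prodMk measurable_snd)).sub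
    (N.measurable_comp_proj.comp measurable_fst)

theorem IsNoisyOracle.batchAvg_noise (N : IsNoisyOracle P Z F fhat ρx ρy L v b D) {t : ℕ}
    (ht : 0 < t) {z : Pt n m} (hz : z ∈ Z) (s : ℕ → Sample Ξ n m) :
    batchGrad fhat ρx ρy t s z - F z = batchAvg (noise Z F fhat ρx ρy) t s z := by
  have h0 : (t : ℝ) ≠ 0 := by positivity
  simp only [batchAvg, batchGrad, noise, proj_eq_self N.nonempty N.closed N.convex hz]
  rw [sum_sub_distrib, sum_const, card_range, smul_sub, ← Nat.cast_smul_eq_nsmul ℝ, smul_smul,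
    inv_mul_cancel₀ h0, one_smul]

variable {Ω : Type*} [MeasurableSpace Ω] {Pr : Measure Ω} [IsProbabilityMeasure Pr]
  {S : ℕ → ℕ → Ω → Sample Ξ n m} {W : Ω → Pt n m} {h t : ℕ} {zs : Pt n m}

theorem IsNoisyOracle.error_sq_le (N : IsNoisyOracle P Z F fhat ρx ρy L v b D)
    (hS : IsSampling P Pr S) (hW : Measurable[history S (pastIndices h)] W) (hWZ : ∀ ω, W ω ∈ Z)
    (ht : 0 < t) :
    MemLp (fun ω => batchGrad fhat ρx ρy t (fun i => S h i ω) (W ω) - F (W ω)) 2 Pr ∧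
      ∫ ω, ‖batchGrad fhat ρx ρy t (fun i => S h i ω) (W ω) - F (W ω)‖ ^ 2 ∂Pr ≤
        v / t + b ^ 2 := by
  have : IsProbabilityMeasure (P.prod ((uniformSphere n).prod (uniformSphere m))) := N.prob
  simp_rw [fun ω => N.batchAvg_noise ht (hWZ ω)]
  exact batchAvg_sq_le N.measurable_noise (hW.mono (hS.history_le _) le_rfl) (hS.measurable h)
    (hS.law h) (hS.indepFun_batch hW) (fun i j => hS.indepFun_batch_pair hW) N.v_nonneg
    (fun a => N.sq_le _ (N.proj_mem a)) (fun a => N.bias_le _ (N.proj_mem a)) ht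

theorem IsNoisyOracle.neg_le_integral_inner_error (N : IsNoisyOracle P Z F fhat ρx ρy L v b D)
    (hS : IsSampling P Pr S) (hW : Measurable[history S (pastIndices h)] W) (hWZ : ∀ ω, W ω ∈ Z)
    (ht : 0 < t) (hzs : zs ∈ Z) :
    -(b * D) ≤ ∫ ω, inner ℝ (batchGrad fhat ρx ρy t (fun i => S h i ω) (W ω) - F (W ω))
      (W ω - zs) ∂Pr := by
  have : IsProbabilityMeasure (P.prod ((uniformSphere n).prod (uniformSphere m))) := N.prob
  simp_rw [fun ω => N.batchAvg_noise ht (hWZ ω)]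
  exact neg_le_integral_inner_batchAvg N.measurable_noise (hW.mono (hS.history_le _) le_rfl)
    (hS.measurable h) (hS.law h) (hS.indepFun_batch hW) N.v_nonneg N.b_nonneg
    (fun a => N.sq_le _ (N.proj_mem a)) (fun a => N.bias_le _ (N.proj_mem a)) ht
    (measurable_id.sub_const zs) (fun ω => N.bounded _ (hWZ ω) _ hzs)

variable {p : Params} {z0 : Pt n m}

theorem IsNoisyOracle.run_mem (N : IsNoisyOracle P Z F fhat ρx ρy L v b D) (hz0 : z0 ∈ Z)
    (s : ℕ → ℕ → Sample Ξ n m) (k : ℕ) :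
    (run Z fhat p z0 s k).1 ∈ Z ∧ (run Z fhat p z0 s k).2.1 ∈ Z := by
  induction k with
  | zero => exact ⟨hz0, hz0⟩
  | succ k ih => exact ⟨N.proj_mem _, ih.1⟩

theorem IsNoisyOracle.measurable_iterate_history {Ω : Type*} {S : ℕ → ℕ → Ω → Sample Ξ n m}
    (N : IsNoisyOracle P Z F fhat p.ρx p.ρy L v b D) (k : ℕ) :
    Measurable[history S (pastIndices (2 * k))]
        (fun ω => (run Z fhat p z0 (fun h i => S h i ω) k).1) ∧
      Measurable[history S (pastIndices (2 * k + 1))]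
        (fun ω => halfPt Z fhat p z0 (fun h i => S h i ω) k) :=
  ⟨((@measurable_run n m Ξ Z fhat p z0 _ Ω (history S (pastIndices (2 * k))) S
      N.measurable N.measurable_proj k).1 fun _ hh _ => measurable_history hh).1,
    ((@measurable_run n m Ξ Z fhat p z0 _ Ω (history S (pastIndices (2 * k + 1))) S
      N.measurable N.measurable_proj k).2 fun _ hh _ => measurable_history hh).2.2⟩

theorem IsNoisyOracle.curGrad_error (N : IsNoisyOracle P Z F fhat p.ρx p.ρy L v b D)
    (hS : IsSampling P Pr S) (hz0 : z0 ∈ Z) (ht : ∀ k, 0 < p.t k) (k : ℕ) :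
    MemLp (fun ω => curGrad Z fhat p z0 (fun h i => S h i ω) k -
        F (run Z fhat p z0 (fun h i => S h i ω) k).1) 2 Pr ∧
      ∫ ω, ‖curGrad Z fhat p z0 (fun h i => S h i ω) k -
        F (run Z fhat p z0 (fun h i => S h i ω) k).1‖ ^ 2 ∂Pr ≤ v / p.t k + b ^ 2 :=
  N.error_sq_le hS (N.measurable_iterate_history k).1 (fun _ => (N.run_mem hz0 _ k).1) (ht k)

/-- The error of the stored gradient at `z^{k-1}`. For `k = 0` it is the one of batch `0`, in
accordance with the truncated subtraction. -/
theorem IsNoisyOracle.oldGrad_error (N : IsNoisyOracle P Z F fhat p.ρx p.ρy L v b D)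
    (hS : IsSampling P Pr S) (hz0 : z0 ∈ Z) (ht : ∀ k, 0 < p.t k) (k : ℕ) :
    MemLp (fun ω => (run Z fhat p z0 (fun h i => S h i ω) k).2.2 -
        F (run Z fhat p z0 (fun h i => S h i ω) k).2.1) 2 Pr ∧
      ∫ ω, ‖(run Z fhat p z0 (fun h i => S h i ω) k).2.2 -
        F (run Z fhat p z0 (fun h i => S h i ω) k).2.1‖ ^ 2 ∂Pr ≤ v / p.t (k - 1) + b ^ 2 := by
  cases k with
  | zero => exact N.curGrad_error hS hz0 ht 0
  | succ k => exact N.curGrad_error hS hz0 ht k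

theorem IsNoisyOracle.integrable_energy (N : IsNoisyOracle P Z F fhat p.ρx p.ρy L v b D)
    (hS : IsSampling P Pr S) (hz0 : z0 ∈ Z) (hzs : zs ∈ Z) (κ : ℝ) (k : ℕ) :
    Integrable (fun ω => ‖(run Z fhat p z0 (fun h i => S h i ω) k).1 - zs‖ ^ 2) Pr ∧
    Integrable (fun ω => energy κ zs (run Z fhat p z0 (fun h i => S h i ω) k).1
      (run Z fhat p z0 (fun h i => S h i ω) k).2.1) Pr := by
  obtain ⟨m1, m2⟩ := (measurable_run (z0 := z0) N.measurable N.measurable_proj k).1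
    fun h _ i => hS.measurable h i
  have hbd : ∀ z ∈ Z, ∀ z' ∈ Z, ‖‖z - z'‖ ^ 2‖ ≤ D ^ 2 := fun z hz z' hz' => by
    rw [Real.norm_of_nonneg (by positivity)]
    exact pow_le_pow_left₀ (norm_nonneg _) (N.bounded z hz z' hz') 2
  have i1 : Integrable (fun ω => ‖(run Z fhat p z0 (fun h i => S h i ω) k).1 - zs‖ ^ 2) Pr :=
    Integrable.of_bound ((m1.sub_const zs).norm.pow_const 2).aestronglyMeasurable (D ^ 2)
      (Filter.Eventually.of_forall fun ω => hbd _ (N.run_mem hz0 _ k).1 _ hzs)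
  have i2 : Integrable (fun ω => ‖(run Z fhat p z0 (fun h i => S h i ω) k).1 -
      (run Z fhat p z0 (fun h i => S h i ω) k).2.1‖ ^ 2) Pr :=
    Integrable.of_bound ((m1.sub m2).norm.pow_const 2).aestronglyMeasurable (D ^ 2)
      (Filter.Eventually.of_forall fun ω =>
        hbd _ (N.run_mem hz0 _ k).1 _ (N.run_mem hz0 _ k).2)
  exact ⟨i1, (i1.const_mul _).add (i2.const_mul _)⟩

/-- One step of the method contracts the expected energy, up to the bias and the variances of the
three batches involved. -/
theorem IsNoisyOracle.integral_energy_succ_le {κ : ℝ} {K : ℕ} (hp : p = params n m L κ K)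
    (N : IsNoisyOracle P Z F fhat p.ρx p.ρy L v b D) (hS : IsSampling P Pr S) (hz0 : z0 ∈ Z)
    (hzs : zs ∈ Z) (hκ : 1 ≤ κ) (ht : ∀ k, 0 < p.t k)
    (hmono : ∀ z ∈ Z, L / κ * ‖z - zs‖ ^ 2 ≤ inner ℝ (F z) (z - zs)) (k : ℕ) :
    ∫ ω, energy κ zs (run Z fhat p z0 (fun h i => S h i ω) (k + 1)).1
        (run Z fhat p z0 (fun h i => S h i ω) (k + 1)).2.1 ∂Pr ≤
      (1 - 1 / (256 * κ)) * ∫ ω, energy κ zs (run Z fhat p z0 (fun h i => S h i ω) k).1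
        (run Z fhat p z0 (fun h i => S h i ω) k).2.1 ∂Pr
      + (1 / (2 * L) * (b * D)
        + 1 / L ^ 2 * ((v / p.t k + b ^ 2) + (v / p.t k + b ^ 2) +
          (v / p.t (k - 1) + b ^ 2))) := by
  have htH : p.tHalf k = p.t k := by rw [hp]; rfl
  obtain ⟨c1, c2⟩ := N.curGrad_error hS hz0 ht k
  obtain ⟨o1, o2⟩ := N.oldGrad_error hS hz0 ht k
  have hhalf : ∀ ω, halfPt Z fhat p z0 (fun h i => S h i ω) k ∈ Z := fun ω => N.proj_mem _
  have hh := N.error_sq_le hS (N.measurable_iterate_history (z0 := z0) k).2 hhalf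
    (t := p.tHalf k) (htH ▸ ht k)
  have hin := N.neg_le_integral_inner_error hS (N.measurable_iterate_history (z0 := z0) k).2 hhalf
    (t := p.tHalf k) (htH ▸ ht k) hzs
  obtain ⟨h1, h2⟩ := hh
  have mW : Measurable fun ω => halfPt Z fhat p z0 (fun h i => S h i ω) k :=
    ((measurable_run N.measurable N.measurable_proj k).2 fun h _ i => hS.measurable h i).2.2
  have hWL : MemLp (fun ω => halfPt Z fhat p z0 (fun h i => S h i ω) k - zs) 2 Pr :=
    MemLp.of_bound (mW.sub_const zs).aestronglyMeasurable D
      (Filter.Eventually.of_forall fun ω => N.bounded _ (hhalf ω) _ hzs)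
  -- the errors of the three batch gradients
  obtain ⟨eh, heh⟩ : ∃ e : Ω → Pt n m, e = fun ω => batchGrad fhat p.ρx p.ρy (p.tHalf k)
    (fun i => S (2 * k + 1) i ω) (halfPt Z fhat p z0 (fun h i => S h i ω) k) -
      F (halfPt Z fhat p z0 (fun h i => S h i ω) k) := ⟨_, rfl⟩
  obtain ⟨ec, hec⟩ : ∃ e : Ω → Pt n m, e = fun ω => curGrad Z fhat p z0 (fun h i => S h i ω) k -
      F (run Z fhat p z0 (fun h i => S h i ω) k).1 := ⟨_, rfl⟩
  obtain ⟨eo, heo⟩ : ∃ e : Ω → Pt n m, e = fun ω => (run Z fhat p z0 (fun h i => S h i ω) k).2.2 -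
      F (run Z fhat p z0 (fun h i => S h i ω) k).2.1 := ⟨_, rfl⟩
  obtain ⟨w, hw⟩ : ∃ w : Ω → Pt n m, w = fun ω =>
    halfPt Z fhat p z0 (fun h i => S h i ω) k - zs := ⟨_, rfl⟩
  have step : ∀ ω, energy κ zs (run Z fhat p z0 (fun h i => S h i ω) (k + 1)).1
        (run Z fhat p z0 (fun h i => S h i ω) (k + 1)).2.1 ≤
      (1 - 1 / (256 * κ)) * energy κ zs (run Z fhat p z0 (fun h i => S h i ω) k).1
        (run Z fhat p z0 (fun h i => S h i ω) k).2.1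
      + (-(1 / (2 * L)) * inner ℝ (eh ω) (w ω)
        + 1 / L ^ 2 * (‖eh ω‖ ^ 2 + ‖ec ω‖ ^ 2 + ‖eo ω‖ ^ 2)) := by
    intro ω
    obtain ⟨r1, r2⟩ := N.run_mem (p := p) hz0 (fun h i => S h i ω) k
    have r3 := (N.run_mem (p := p) hz0 (fun h i => S h i ω) (k + 1)).1
    subst heh hec heo hw
    refine energy_step N.L_pos hκ (h := halfGrad Z fhat p z0 (fun h i => S h i ω) k)
      (g := curGrad Z fhat p z0 (fun h i => S h i ω) k)
      (go := (run Z fhat p z0 (fun h i => S h i ω) k).2.2)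
      (w := halfPt Z fhat p z0 (fun h i => S h i ω) k) ?_ ?_ (hmono _ (hhalf ω))
      (N.lip _ (hhalf ω) _ r1) (N.lip _ r1 _ r2)
    · have := inner_sub_proj_le_zero N.nonempty N.closed N.convex
        ((run Z fhat p z0 (fun h i => S h i ω) k).1
          + p.β • ((run Z fhat p z0 (fun h i => S h i ω) k).1 -
            (run Z fhat p z0 (fun h i => S h i ω) k).2.1)
          - p.η • curGrad Z fhat p z0 (fun h i => S h i ω) k) r3
      subst hp
      exact this
    · have := inner_sub_proj_le_zero N.nonempty N.closed N.convex
        ((run Z fhat p z0 (fun h i => S h i ω) k).1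
          - p.α • halfGrad Z fhat p z0 (fun h i => S h i ω) k
          + p.γ • ((run Z fhat p z0 (fun h i => S h i ω) k).1 -
            (run Z fhat p z0 (fun h i => S h i ω) k).2.1)
          - p.τ • (curGrad Z fhat p z0 (fun h i => S h i ω) k -
            (run Z fhat p z0 (fun h i => S h i ω) k).2.2)) hzs
      subst hp
      exact this
  rw [← heh] at h1
  rw [← hec] at c1
  rw [← heo] at o1
  rw [← hw] at hWL
  replace h2 : ∫ ω, ‖eh ω‖ ^ 2 ∂Pr ≤ v / p.t k + b ^ 2 := by
    rw [← htH, heh]; exact h2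
  replace c2 : ∫ ω, ‖ec ω‖ ^ 2 ∂Pr ≤ v / p.t k + b ^ 2 := hec ▸ c2
  replace o2 : ∫ ω, ‖eo ω‖ ^ 2 ∂Pr ≤ v / p.t (k - 1) + b ^ 2 := heo ▸ o2
  replace hin : -(b * D) ≤ ∫ ω, inner ℝ (eh ω) (w ω) ∂Pr := by rw [heh, hw]; exact hin
  have sq : ∀ {e : Ω → Pt n m}, MemLp e 2 Pr → Integrable (fun ω => ‖e ω‖ ^ 2) Pr := fun he =>
    (memLp_two_iff_integrable_sq_norm he.aestronglyMeasurable).1 he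
  have i0 := (N.integrable_energy hS hz0 hzs κ k).2
  have i1 := integrable_inner_of_memLp_two h1 hWL
  have i2 : Integrable (fun ω => ‖eh ω‖ ^ 2 + ‖ec ω‖ ^ 2) Pr := (sq h1).add (sq c1)
  have i3 : Integrable (fun ω => ‖eh ω‖ ^ 2 + ‖ec ω‖ ^ 2 + ‖eo ω‖ ^ 2) Pr := i2.add (sq o1)
  have i4 : Integrable (fun ω => -(1 / (2 * L)) * inner ℝ (eh ω) (w ω)
      + 1 / L ^ 2 * (‖eh ω‖ ^ 2 + ‖ec ω‖ ^ 2 + ‖eo ω‖ ^ 2)) Pr :=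
    (i1.const_mul _).add (i3.const_mul _)
  refine (integral_mono (N.integrable_energy hS hz0 hzs κ (k + 1)).2
    ((i0.const_mul (1 - 1 / (256 * κ))).add i4) step).trans ?_
  simp only [Pi.add_apply]
  rw [integral_add (i0.const_mul _) i4, integral_add (i1.const_mul _) (i3.const_mul _),
    integral_const_mul, integral_const_mul, integral_const_mul, integral_add i2 (sq o1),
    integral_add (sq h1) (sq c1)]
  have hL := N.L_pos
  have g1 : -(1 / (2 * L)) * ∫ ω, inner ℝ (eh ω) (w ω) ∂Pr ≤ 1 / (2 * L) * (b * D) := by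
    rw [neg_mul, ← mul_neg]
    exact mul_le_mul_of_nonneg_left (by linarith) (by positivity)
  gcongr

end Recursion

/-! ### Batch sizes and the number of iterations -/

section Parameters
variable {κ : ℝ} {K : ℕ}

theorem rate_mem (hκ : 1 ≤ κ) :
    1 / 2 ≤ 1 - 1 / (256 * κ) ∧ 1 - 1 / (256 * κ) < 1 := by
  have h1 : 0 < 1 / (256 * κ) := by positivity
  have h2 : 1 / (256 * κ) ≤ 1 / 2 := by
    rw [div_le_div_iff₀ (by positivity) (by norm_num)]; linarith
  constructor <;> linarith

theorem le_batchSize (k : ℕ) : (K : ℝ) / (1 - 1 / (256 * κ)) ^ (k + 1) ≤ batchSize κ K k := by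
  refine le_trans (le_of_eq ?_) (Nat.le_ceil _)
  rw [zpow_neg, div_eq_mul_inv]
  norm_cast

theorem batchSize_pos (hκ : 1 ≤ κ) (hK : 1 ≤ K) (k : ℕ) : 0 < batchSize κ K k := by
  have hq : 0 < 1 - 1 / (256 * κ) := by linarith [(rate_mem hκ).1]
  have h := le_batchSize (κ := κ) (K := K) k
  have h1 : 0 < (K : ℝ) / (1 - 1 / (256 * κ)) ^ (k + 1) := by positivity
  exact_mod_cast h1.trans_le h

theorem batchSize_le (hκ : 1 ≤ κ) (hK : 1 ≤ K) (k : ℕ) :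
    (batchSize κ K k : ℝ) ≤ 2 * (K * (1 - 1 / (256 * κ))⁻¹ ^ (k + 1)) := by
  obtain ⟨h1, h2⟩ := rate_mem hκ
  have h3 : (1 : ℝ) ≤ (1 - 1 / (256 * κ))⁻¹ ^ (k + 1) :=
    one_le_pow₀ ((one_le_inv₀ (by linarith)).2 h2.le)
  have hK' : (1 : ℝ) ≤ K := by exact_mod_cast hK
  have h4 : (K : ℝ) * (1 - 1 / (256 * κ)) ^ (-((k : ℤ) + 1)) =
      K * (1 - 1 / (256 * κ))⁻¹ ^ (k + 1) := by
    rw [zpow_neg, inv_pow]; norm_cast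
  have h5 := Nat.ceil_lt_add_one (a := (K : ℝ) * (1 - 1 / (256 * κ))⁻¹ ^ (k + 1)) (by positivity)
  rw [batchSize, h4]
  nlinarith

theorem div_batchSize_le (hκ : 1 ≤ κ) (hK : 1 ≤ K) {v : ℝ} (hv : 0 ≤ v) (k : ℕ) :
    v / batchSize κ K k ≤ v / K * (1 - 1 / (256 * κ)) ^ (k + 1) := by
  have hq : 0 < 1 - 1 / (256 * κ) := by linarith [(rate_mem hκ).1]
  have hK' : (0 : ℝ) < K := by exact_mod_cast hK
  calc v / batchSize κ K k ≤ v / (K / (1 - 1 / (256 * κ)) ^ (k + 1)) :=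
        div_le_div_of_nonneg_left hv (by positivity) (le_batchSize k)
    _ = _ := by field_simp

/-- The geometric growth of the batch sizes makes the last batches dominate the total. -/
theorem totalSamples_le (n m : ℕ) (L : ℝ) (hκ : 1 ≤ κ) (hK : 1 ≤ K) :
    (totalSamples (params n m L κ K) K : ℝ) ≤
      1024 * K * κ * (1 - 1 / (256 * κ))⁻¹ ^ K := by
  obtain ⟨h1, h2⟩ := rate_mem hκ
  obtain ⟨r, hr⟩ : ∃ r, r = (1 - 1 / (256 * κ))⁻¹ := ⟨_, rfl⟩
  -- the summands of the geometric series telescope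
  have hr1 : r = 256 * κ * (r - 1) := by
    have h3 : (1 - 1 / (256 * κ)) ≠ 0 := by linarith
    have h4 : (1 - 1 / (256 * κ)) * r = 1 := by rw [hr]; exact mul_inv_cancel₀ h3
    have hκ0 : κ ≠ 0 := by linarith
    have h5 : 256 * κ * (1 / (256 * κ)) = 1 := by field_simp
    linear_combination (-256 * κ) * h4 - r * h5
  have hgeom : ∑ k ∈ range K, r ^ (k + 1) = 256 * κ * (r ^ K - 1) := by
    rw [← pow_zero r, ← sum_range_sub (fun k => r ^ k), mul_sum]
    refine sum_congr rfl fun k _ => ?_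
    linear_combination r ^ k * hr1
  have hsum : (totalSamples (params n m L κ K) K : ℝ) ≤
      ∑ k ∈ range K, 4 * K * r ^ (k + 1) := by
    rw [totalSamples, Nat.cast_sum]
    refine sum_le_sum fun k _ => ?_
    have := batchSize_le hκ hK k
    rw [← hr] at this
    simp only [params, Nat.cast_add]
    linarith
  rw [← mul_sum, hgeom] at hsum
  rw [← hr]
  have : (0 : ℝ) ≤ 1024 * K * κ := by positivity
  linarith

/-- The number of iterations `K` is the least one with `q ^ K ≤ ε / c`, where
`q = 1 - 1 / (256 κ)`. The minimality also bounds `q ^ (-K)`, hence the batch sizes, by a multiple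
of `1 / ε`, which the cruder choice `K ≈ 256 κ log (c / ε)` would not. -/
theorem exists_iterations {c : ℝ} (hc : 1 ≤ c) : ∃ C : ℝ, 0 < C ∧ ∀ κ : ℝ, 1 ≤ κ → ∀ ε : ℝ,
    0 < ε → ε ≤ 1 / 2 → ∃ K : ℕ, 1 ≤ K ∧ (K : ℝ) ≤ C * (κ * Real.log (1 / ε)) ∧
      (∀ (n m : ℕ) (L : ℝ), (totalSamples (params n m L κ K) K : ℝ) ≤
        C * (κ ^ 2 / ε * Real.log (1 / ε))) ∧ c * (1 - 1 / (256 * κ)) ^ K ≤ ε := by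
  have hlc : 0 ≤ Real.log c := Real.log_nonneg hc
  obtain ⟨a, ha⟩ : ∃ a, a = 512 * Real.log c + 258 := ⟨_, rfl⟩
  have ha0 : 0 < a := by rw [ha]; positivity
  refine ⟨2048 * a * c, by positivity, fun κ hκ ε hε hε2 => ?_⟩
  obtain ⟨h1, h2⟩ := rate_mem hκ
  obtain ⟨q, hq⟩ : ∃ q, q = 1 - 1 / (256 * κ) := ⟨_, rfl⟩
  rw [← hq] at h1 h2
  have hq0 : 0 < q := by linarith
  have hc0 : 0 < c := by linarith
  have hex : ∃ K : ℕ, q ^ K ≤ ε / c := by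
    obtain ⟨K, hK⟩ := exists_pow_lt_of_lt_one (div_pos hε hc0) h2
    exact ⟨K, hK.le⟩
  classical
  obtain ⟨K, hK, hmin⟩ : ∃ K : ℕ, q ^ K ≤ ε / c ∧ ∀ j < K, ε / c < q ^ j :=
    ⟨Nat.find hex, Nat.find_spec hex, fun j hj => not_le.1 (Nat.find_min hex hj)⟩
  have hK1 : 1 ≤ K := by
    rcases Nat.eq_zero_or_pos K with rfl | h
    · rw [pow_zero, le_div_iff₀ hc0] at hK
      linarith
    · exact h
  have hprev := hmin (K - 1) (by omega)
  obtain ⟨ℓ, hℓ⟩ : ∃ ℓ, ℓ = Real.log (1 / ε) := ⟨_, rfl⟩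
  have hℓ1 : 1 / 2 ≤ ℓ := by
    have h3 : Real.log 2 ≤ ℓ := by
      rw [hℓ]
      exact Real.log_le_log (by norm_num) (by rw [le_div_iff₀ hε]; linarith)
    linarith [Real.log_two_gt_d9]
  -- the bound on `K` comes from `q ≤ exp (-1 / (256 κ))`
  have hKle : (K : ℝ) ≤ a * (κ * ℓ) := by
    have h3 : q ^ (K - 1) ≤ Real.exp (-(1 / (256 * κ)) * ((K : ℝ) - 1)) := by
      have h4 : q ≤ Real.exp (-(1 / (256 * κ))) := by
        have := Real.add_one_le_exp (-(1 / (256 * κ)))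
        rw [hq]; linarith
      calc q ^ (K - 1) ≤ Real.exp (-(1 / (256 * κ))) ^ (K - 1) := by gcongr
        _ = _ := by rw [← Real.exp_nat_mul, Nat.cast_sub hK1, Nat.cast_one, mul_comm]
    have h5 := Real.log_lt_log (by positivity) (hprev.trans_le h3)
    rw [Real.log_exp, Real.log_div hε.ne' hc0.ne'] at h5
    have h6 : Real.log ε = -ℓ := by rw [hℓ, one_div, Real.log_inv, neg_neg]
    rw [h6] at h5
    have h7 : (K : ℝ) - 1 ≤ 256 * κ * (ℓ + Real.log c) := by
      have h8 : 1 / (256 * κ) * ((K : ℝ) - 1) ≤ ℓ + Real.log c := by linarith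
      rwa [one_div, inv_mul_le_iff₀ (by positivity)] at h8
    have h9 : 1 ≤ 2 * (κ * ℓ) := by nlinarith
    have h10 : κ * Real.log c ≤ 2 * (κ * ℓ) * Real.log c := by
      have : κ * Real.log c * 1 ≤ κ * Real.log c * (2 * ℓ) := by gcongr; linarith
      linarith
    rw [ha]
    linarith
  have hinv : q⁻¹ ^ K ≤ 2 * c / ε := by
    have h3 : ε / (2 * c) ≤ q ^ K := by
      obtain ⟨j, rfl⟩ : ∃ j, K = j + 1 := ⟨K - 1, by omega⟩
      rw [Nat.add_sub_cancel] at hprev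
      rw [pow_succ]
      calc ε / (2 * c) = ε / c * (1 / 2) := by field_simp
        _ ≤ q ^ j * q := by gcongr
    rw [inv_pow]
    calc (q ^ K)⁻¹ ≤ (ε / (2 * c))⁻¹ := by gcongr
      _ = _ := by rw [inv_div]
  refine ⟨K, hK1, ?_, fun n m L => ?_, ?_⟩
  · rw [← hℓ]
    refine hKle.trans (mul_le_mul_of_nonneg_right ?_ (by positivity))
    nlinarith
  · rw [← hℓ]
    calc _ ≤ 1024 * K * κ * (1 - 1 / (256 * κ))⁻¹ ^ K := totalSamples_le n m L hκ hK1
      _ ≤ 1024 * (a * (κ * ℓ)) * κ * (2 * c / ε) := by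
        rw [← hq]
        gcongr
      _ = _ := by field_simp; ring
  · rw [← hq, mul_comm]
    rwa [le_div_iff₀ hc0] at hK

end Parameters

/-! ### Convergence -/

section Convergence
variable {n m : ℕ} {Ξ : Type*} [MeasurableSpace Ξ] {P : Measure Ξ}
  {fhat : E n → E m → Ξ → ℝ} {L v b D κ : ℝ} {K : ℕ} {p : Params} {z0 zs : Pt n m}

/-- The growing batches make the variance contribute `O(q ^ k)` to the energy, and the small
smoothing radii make the bias contribute `O(q ^ K)`. -/
theorem IsNoisyOracle.integral_energy_le {Z : Set (Pt n m)} {F : Pt n m → Pt n m} {Ω : Type*}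
    [MeasurableSpace Ω] {Pr : Measure Ω} [IsProbabilityMeasure Pr]
    {S : ℕ → ℕ → Ω → Sample Ξ n m} (hp : p = params n m L κ K)
    (N : IsNoisyOracle P Z F fhat p.ρx p.ρy L v b D) (hS : IsSampling P Pr S) (hz0 : z0 ∈ Z)
    (hzs : zs ∈ Z) (hκ : 1 ≤ κ) (hK : 1 ≤ K) (hD : 0 ≤ D)
    (hb : b ≤ 2 * (L / κ) * (1 - 1 / (256 * κ)) ^ K)
    (hmono : ∀ z ∈ Z, L / κ * ‖z - zs‖ ^ 2 ≤ inner ℝ (F z) (z - zs)) (k : ℕ) :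
    ∫ ω, energy κ zs (run Z fhat p z0 (fun h i => S h i ω) k).1
        (run Z fhat p z0 (fun h i => S h i ω) k).2.1 ∂Pr ≤
      (1 - 1 / (256 * κ)) ^ k * (D ^ 2 + k * (4 * v / L ^ 2 / K))
        + 256 * (D + 12) * (1 - 1 / (256 * κ)) ^ K := by
  obtain ⟨h1, h2⟩ := rate_mem hκ
  have hκ0 : 0 < κ := by linarith
  have hL := N.L_pos
  have ht : ∀ k, p.t k = batchSize κ K k := fun k => by rw [hp]; rfl
  have htpos : ∀ k, 0 < p.t k := fun k => by rw [ht]; exact batchSize_pos hκ hK k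
  have hstep := N.integral_energy_succ_le hp hS hz0 hzs hκ htpos hmono
  obtain ⟨q, hq⟩ : ∃ q, q = 1 - 1 / (256 * κ) := ⟨_, rfl⟩
  have hdiv : ∀ k, v / p.t k ≤ v / K * q ^ (k + 1) := fun k => by
    rw [ht, hq]; exact div_batchSize_le hκ hK N.v_nonneg k
  simp only [← hq] at h1 h2 hb hstep ⊢
  have hq0 : 0 < q := by linarith
  induction k with
  | zero =>
    have h3 : ∀ ω, energy κ zs (run Z fhat p z0 (fun h i => S h i ω) 0).1
        (run Z fhat p z0 (fun h i => S h i ω) 0).2.1 ≤ D ^ 2 := by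
      intro ω
      have h4 : ‖z0 - zs‖ ^ 2 ≤ D ^ 2 :=
        pow_le_pow_left₀ (norm_nonneg _) (N.bounded _ hz0 _ hzs) 2
      have h5 : 0 ≤ 1 / (32 * κ) * ‖z0 - zs‖ ^ 2 := by positivity
      simp only [run, energy, sub_self, norm_zero]
      linarith
    have h6 := integral_mono (N.integrable_energy hS hz0 hzs κ 0).2
      (integrable_const (D ^ 2)) h3
    have h7 : 0 ≤ 256 * (D + 12) * q ^ K := by positivity
    simp only [integral_const, probReal_univ, smul_eq_mul, one_mul] at h6
    simp only [pow_zero, Nat.cast_zero]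
    linarith
  | succ k ih =>
    refine (hstep k).trans ?_
    have hqK : q ^ K ≤ 1 := pow_le_one₀ hq0.le h2.le
    have hqK0 : 0 < q ^ K := by positivity
    have hvK : 0 ≤ v / K := div_nonneg N.v_nonneg (Nat.cast_nonneg K)
    -- the bias
    have e1 : 1 / (2 * L) * (b * D) ≤ D / κ * q ^ K := by
      calc 1 / (2 * L) * (b * D) ≤ 1 / (2 * L) * (2 * (L / κ) * q ^ K * D) := by gcongr
        _ = _ := by field_simp
    have e2 : 1 / L ^ 2 * (3 * b ^ 2) ≤ 12 / κ * q ^ K := by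
      calc 1 / L ^ 2 * (3 * b ^ 2) ≤ 1 / L ^ 2 * (3 * (2 * (L / κ) * q ^ K) ^ 2) := by
            have := N.b_nonneg
            gcongr
        _ = 12 / κ * q ^ K * (q ^ K * (1 / κ)) := by field_simp; ring
        _ ≤ 12 / κ * q ^ K * 1 := by
            have h3 : 1 / κ ≤ 1 := by rw [div_le_one hκ0]; exact hκ
            gcongr
            exact mul_le_one₀ hqK (by positivity) h3
        _ = _ := mul_one _
    -- the variance
    have e3 : v / p.t (k - 1) ≤ 2 * (v / K * q ^ (k + 1)) := by
      have h3 : q ^ (k - 1 + 1) ≤ 2 * q ^ (k + 1) := by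
        rcases Nat.eq_zero_or_pos k with rfl | hk
        · simp only [Nat.zero_sub, zero_add, pow_one]; linarith
        · rw [Nat.sub_add_cancel hk, pow_succ]
          nlinarith [pow_pos hq0 k]
      calc _ ≤ v / K * q ^ (k - 1 + 1) := hdiv _
        _ ≤ v / K * (2 * q ^ (k + 1)) := by gcongr
        _ = _ := by ring
    have e4 : 1 / L ^ 2 * (v / p.t k + v / p.t k + v / p.t (k - 1)) ≤
        4 * v / L ^ 2 / K * q ^ (k + 1) := by
      calc _ ≤ 1 / L ^ 2 * (4 * (v / K * q ^ (k + 1))) := by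
            have := hdiv k
            gcongr
            linarith
        _ = _ := by ring
    have e5 := mul_le_mul_of_nonneg_left ih hq0.le
    have e6 : (256 * (D + 12) * q ^ K) * q =
        256 * (D + 12) * q ^ K - (D / κ * q ^ K + 12 / κ * q ^ K) := by
      rw [hq]; field_simp
    have e7 : q * (q ^ k * (D ^ 2 + k * (4 * v / L ^ 2 / K)) + 256 * (D + 12) * q ^ K) =
        q ^ (k + 1) * (D ^ 2 + k * (4 * v / L ^ 2 / K)) + (256 * (D + 12) * q ^ K) * q := by
      ring
    push_cast
    linarith

variable {X : Set (E n)} {Y : Set (E m)} {f : E n → E m → ℝ} {μ Lx Ly Lxy M σ : ℝ}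
  [IsProbabilityMeasure P]

theorem IsOracle.isNoisyOracle (O : IsOracle P X Y f fhat σ)
    (H : IsProblem X Y f μ Lx Ly Lxy M D) (hn : 1 ≤ n) (hm : 1 ≤ m)
    (hL : L = 2 * max Lx (max Ly Lxy)) (hL0 : 0 < L) (hne : (feasible X Y).Nonempty)
    {ρx ρy : ℝ} (hρx : 0 < ρx) (hρx1 : ρx ≤ 1) (hρy : 0 < ρy) (hρy1 : ρy ≤ 1) :
    IsNoisyOracle P (feasible X Y) (gradOp f) fhat ρx ρy L
      (4 * (n ^ 2 + m ^ 2) * (σ ^ 2 + (M + L) ^ 2) + 4 * M ^ 2) (n * L * ρx + m * L * ρy) D := by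
  have hmax : max Lx (max Ly Lxy) ≤ L := by linarith
  have hLx : Lx ≤ L := (le_max_left _ _).trans hmax
  have hLy : Ly ≤ L := ((le_max_left _ _).trans (le_max_right _ _)).trans hmax
  exact
  { nonempty := hne
    closed := H.isClosed_feasible
    convex := H.convex_feasible
    bounded := H.bounded
    prob := isProbabilityMeasure_sampleLaw hn hm
    L_pos := hL0
    lip := fun z hz z' hz' => H.norm_gradOp_sub_le hL hL0 hz hz'
    measurable := O.measurable_zoGrad
    v_nonneg := by positivity
    b_nonneg := by positivity
    sq_le := fun z hz => O.zoGrad_sub_sq_le H hn hm hL0.le hLx hLy hρx hρx1 hρy hρy1 hz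
    bias_le := fun z hz =>
      O.norm_integral_zoGrad_sub_le H hn hm hL0.le hLx hLy hρx hρx1 hρy hρy1 hz }

theorem smoothing_radius_mem (hn : 1 ≤ n) (hκ : 1 ≤ κ) :
    0 < 1 / (Real.sqrt 2 * n * κ) * (1 - 1 / (256 * κ)) ^ K ∧
      1 / (Real.sqrt 2 * n * κ) * (1 - 1 / (256 * κ)) ^ K ≤ 1 ∧
      n * L * (1 / (Real.sqrt 2 * n * κ) * (1 - 1 / (256 * κ)) ^ K) =
        1 / Real.sqrt 2 * (L / κ * (1 - 1 / (256 * κ)) ^ K) := by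
  obtain ⟨h1, h2⟩ := rate_mem hκ
  have hq0 : 0 < 1 - 1 / (256 * κ) := by linarith
  have hn' : (1 : ℝ) ≤ n := by exact_mod_cast hn
  have hs : (1 : ℝ) ≤ Real.sqrt 2 := Real.one_le_sqrt.2 one_le_two
  have hsn : 1 ≤ Real.sqrt 2 * n * κ :=
    one_le_mul_of_one_le_of_one_le (one_le_mul_of_one_le_of_one_le hs hn') hκ
  refine ⟨by positivity, mul_le_one₀ ?_ (by positivity) (pow_le_one₀ hq0.le h2.le), ?_⟩
  · rw [div_le_one (by positivity)]; exact hsn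
  · field_simp

/-- After `K` iterations the mean square distance to the solution is `O(q ^ K)`. -/
theorem integral_iterate_sub_sq_le {Ω : Type*} [MeasurableSpace Ω] {Pr : Measure Ω}
    [IsProbabilityMeasure Pr] {S : ℕ → ℕ → Ω → Sample Ξ n m} (O : IsOracle P X Y f fhat σ)
    (H : IsProblem X Y f μ Lx Ly Lxy M D) (hn : 1 ≤ n) (hm : 1 ≤ m)
    (hL : L = 2 * max Lx (max Ly Lxy)) (hμ : 0 < μ) (hμL : μ ≤ L) (hK : 1 ≤ K)
    (hS : IsSampling P Pr S) (hz0 : z0 ∈ feasible X Y) (hzs : IsSolution X Y f zs) :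
    Integrable (fun ω => ‖iterate (feasible X Y) fhat (params n m L (L / μ) K) z0
        (fun h i => S h i ω) K - zs‖ ^ 2) Pr ∧
      ∫ ω, ‖iterate (feasible X Y) fhat (params n m L (L / μ) K) z0
        (fun h i => S h i ω) K - zs‖ ^ 2 ∂Pr ≤
      2 * (D ^ 2 + 4 * (4 * (n ^ 2 + m ^ 2) * (σ ^ 2 + (M + L) ^ 2) + 4 * M ^ 2) / L ^ 2
        + 256 * (D + 12)) * (1 - 1 / (256 * (L / μ))) ^ K := by
  have hL0 : 0 < L := by linarith
  have hκ : 1 ≤ L / μ := (one_le_div hμ).2 hμL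
  have hLκ : L / (L / μ) = μ := by field_simp
  obtain ⟨x1, x2, x3⟩ := smoothing_radius_mem (K := K) (L := L) hn hκ
  obtain ⟨y1, y2, y3⟩ := smoothing_radius_mem (K := K) (L := L) hm hκ
  have N := O.isNoisyOracle H hn hm hL hL0 ⟨z0, hz0⟩ x1 x2 y1 y2
  have hD : 0 ≤ D := (norm_nonneg _).trans (H.bounded z0 hz0 z0 hz0)
  have hq0 : 0 < 1 - 1 / (256 * (L / μ)) := by linarith [(rate_mem hκ).1]
  have hb : n * L * (1 / (Real.sqrt 2 * n * (L / μ)) * (1 - 1 / (256 * (L / μ))) ^ K)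
      + m * L * (1 / (Real.sqrt 2 * m * (L / μ)) * (1 - 1 / (256 * (L / μ))) ^ K) ≤
      2 * (L / (L / μ)) * (1 - 1 / (256 * (L / μ))) ^ K := by
    rw [x3, y3]
    have hs : 1 / Real.sqrt 2 ≤ 1 := by
      rw [div_le_one (by positivity)]; exact Real.one_le_sqrt.2 one_le_two
    have h0 : 0 ≤ L / (L / μ) * (1 - 1 / (256 * (L / μ))) ^ K := by positivity
    have := mul_le_mul_of_nonneg_right hs h0
    linarith
  have hmain := N.integral_energy_le (p := params n m L (L / μ) K) (z0 := z0) (zs := zs) rfl hS hz0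
    hzs.1 hκ hK hD hb (fun z hz => by rw [hLκ]; exact H.inner_gradOp_ge hz hzs) K
  obtain ⟨i1, i2⟩ := N.integrable_energy (p := params n m L (L / μ) K) hS hz0 hzs.1 (L / μ) K
  refine ⟨i1, ?_⟩
  have hle := integral_mono i1 (i2.const_mul 2) fun ω => norm_sub_sq_le_energy hκ _ _ _
  rw [integral_const_mul] at hle
  refine hle.trans ((mul_le_mul_of_nonneg_left hmain zero_le_two).trans_eq ?_)
  have hK0 : (K : ℝ) ≠ 0 := by positivity
  field_simp

end Convergence

end SZO

end

theorem proposition3 (n m : ℕ) (hn : 1 ≤ n) (hm : 1 ≤ m) (L M σ D : ℝ) :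
    ∃ C : ℝ, 0 < C ∧
      ∀ μ : ℝ, 0 < μ → μ ≤ L → ∀ ε : ℝ, 0 < ε → ε ≤ 1 / 2 →
        ∃ K : ℕ, 1 ≤ K ∧
          (K : ℝ) ≤ C * ((L / μ) * Real.log (1 / ε)) ∧
          (SZO.totalSamples (SZO.params n m L (L / μ) K) K : ℝ) ≤
            C * ((L / μ) ^ 2 / ε * Real.log (1 / ε)) ∧
          ∀ (X : Set (SZO.E n)) (Y : Set (SZO.E m)) (f : SZO.E n → SZO.E m → ℝ)
            (Lx Ly Lxy : ℝ), L = 2 * max Lx (max Ly Lxy) →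
            SZO.IsProblem X Y f μ Lx Ly Lxy M D →
            ∀ (Ξ : Type*) [MeasurableSpace Ξ] (P : Measure Ξ) [IsProbabilityMeasure P]
              (fhat : SZO.E n → SZO.E m → Ξ → ℝ), SZO.IsOracle P X Y f fhat σ →
            ∀ (Ω : Type*) [MeasurableSpace Ω] (Pr : Measure Ω) [IsProbabilityMeasure Pr]
              (S : ℕ → ℕ → Ω → SZO.Sample Ξ n m), SZO.IsSampling P Pr S →
            ∀ z0 ∈ SZO.feasible X Y, ∀ zs : SZO.Pt n m, SZO.IsSolution X Y f zs →
              Integrable (fun ω => ‖SZO.iterate (SZO.feasible X Y) fhat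
                (SZO.params n m L (L / μ) K) z0 (fun h i => S h i ω) K - zs‖ ^ 2) Pr ∧
              ∫ ω, ‖SZO.iterate (SZO.feasible X Y) fhat
                (SZO.params n m L (L / μ) K) z0 (fun h i => S h i ω) K - zs‖ ^ 2 ∂Pr ≤ ε := by
  obtain ⟨c, hc⟩ : ∃ c, c = 1 + 2 * (|D| ^ 2 + 4 * (4 * (n ^ 2 + m ^ 2) * (σ ^ 2 + (M + L) ^ 2)
    + 4 * M ^ 2) / L ^ 2 + 256 * (|D| + 12)) := ⟨_, rfl⟩
  have hc1 : 1 ≤ c := by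
    rw [hc, le_add_iff_nonneg_right]
    positivity
  obtain ⟨C, hC, hex⟩ := SZO.exists_iterations hc1
  refine ⟨C, hC, fun μ hμ hμL ε hε hε2 => ?_⟩
  have hκ : 1 ≤ L / μ := (one_le_div hμ).2 hμL
  obtain ⟨K, hK, hKC, hT, hcK⟩ := hex (L / μ) hκ ε hε hε2
  refine ⟨K, hK, hKC, hT n m L, ?_⟩
  intro X Y f Lx Ly Lxy hL H Ξ _ P _ fhat O Ω _ Pr _ S hS z0 hz0 zs hzs
  obtain ⟨hint, hle⟩ := SZO.integral_iterate_sub_sq_le O H hn hm hL hμ hμL hK hS hz0 hzs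
  refine ⟨hint, hle.trans (le_trans ?_ hcK)⟩
  have hD : 0 ≤ D := (norm_nonneg _).trans (H.bounded z0 hz0 z0 hz0)
  have hq0 : 0 ≤ 1 - 1 / (256 * (L / μ)) := by linarith [(SZO.rate_mem hκ).1]
  rw [hc, abs_of_nonneg hD]
  refine mul_le_mul_of_nonneg_right ?_ (pow_nonneg hq0 K)
  linarith
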